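/- **Proposition 4.3.** *Setting.* A metric space $(T,d)$ is a real tree if any two points $\sigma,\sigma'$ are joined by a geodesic (an isometry $f:[0,d(\sigma,\sigma')]\to T$ with $f(0)=\sigma$, $f(d(\sigma,\sigma'))=\sigma'$), with image denoted $[\![\sigma,\sigma']\!]$, and if $q([0,1])=[\![q(0),q(1)]\!]$ for every continuous injective $q:[0,1]\to T$. Let $(T,d,\rho)$ be a compact real tree with root $\rho\in T$. The degree of $\sigma$ is the (possibly infinite) number of connected components of $T\setminus\{\sigma\}$; $\mathrm{Lf}(T)$ (resp. $\mathrm{Br}(T)$) is the set of $\sigma\neq\rho$ of degree $1$ (resp. at least $3$); $\sigma\wedge\sigma'$ is defined by $[\![\rho,\sigma\wedge\sigma']\!]=[\![\rho,\sigma]\!]\cap[\![\rho,\sigma']\!]$. *Uniform shuffling.* Let $U_{s,C}$ be independent random variables, uniform on $[0,1]$, indexed by all pairs $(s,C)$ where $s\in\mathrm{Br}(T)\cup\{\rho\}$ and $C$ is a connected component of $T\setminus\{s\}$ not containing $\rho$. Define the random relation $\leq_{\rm Sh}$ on $T$ as follows: if $b=\sigma\wedge\sigma'\in\{\sigma,\sigma'\}$,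 then $\sigma\leq_{\rm Sh}\sigma'$ iff $\sigma\in[\![\rho,\sigma']\!]$; otherwise $\sigma\leq_{\rm Sh}\sigma'$ iff $U_{b,C}\leq U_{b,C'}$, where $C\ni\sigma$ and $C'\ni\sigma'$ are components of $T\setminus\{b\}$. *Coding.* A height function with lifetime $M\geq0$ is a function $h:[0,M]\to[0,\infty)$, left-continuous with right limits, with $h(0)=h(0+)=0$ and $h(t+)\leq h(t)$ for $t\in[0,M)$. Put $d_h(s,t)=h(s)+h(t)-2\inf_{[s\wedge t,s\vee t]}h$, let $(T_h,d_h)$ be the quotient of $[0,M]$ by $\{d_h=0\}$, let $p_h:[0,M]\to T_h$ be the projection, $\rho_h=p_h(0)$, $\ell(\sigma)=\inf p_h^{-1}(\{\sigma\})$, $\sigma\leq_h\sigma'$ iff $\ell(\sigma)\leq\ell(\sigma')$, and let $\mu_h$ be the image under $p_h$ of Lebesgue measure on $[0,M]$. Put $r(\sigma)=\inf\{t>\ell(\sigma):p_h(t)\neq\sigma\}$ (equal to $M$ if there is no such $t\in[0,M]$); $h$ is minimal if $[0,M]\setminus\bigcup_{\sigma\in T_h}[\ell(\sigma),r(\sigma)]$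 is Lebesgue-null. For a finite Borel measure $\mu$ on $T$, say that $h$ codes $(T,d,\rho,\leq_{\rm Sh},\mu)$ if there is an isometry from $T$ onto $T_h$ mapping $\rho$ to $\rho_h$, $\leq_{\rm Sh}$ to $\leq_h$ and $\mu$ to $\mu_h$. *Statement.* Assume that $\mathrm{Lf}(T)$ is dense in $T$. Then, almost surely, for every finite Borel measure $\mu$ on $T$ whose topological support is $T$, there is a unique minimal height function coding $(T,d,\rho,\leq_{\rm Sh},\mu)$, and it is continuous on $[0,M]$. -/

import Mathlib

open Set Filter Topology MeasureTheory ProbabilityTheory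

noncomputable section

namespace RealTree

section Trees

variable {T : Type*} [MetricSpace T]

/-- `f`, restricted to `[0, d(σ, σ')]`, is an isometry with `f 0 = σ` and `f (d(σ, σ')) = σ'`. -/
def IsGeodesic (f : ℝ → T) (σ σ' : T) : Prop :=
  f 0 = σ ∧ f (dist σ σ') = σ' ∧
    ∀ s ∈ Icc 0 (dist σ σ'), ∀ t ∈ Icc 0 (dist σ σ'), dist (f s) (f t) = |s - t|

/-- The segment `⟦σ, σ'⟧`: the image of the geodesic from `σ` to `σ'`. (In a real tree this
geodesic is unique; in general this is the union of the images of all geodesics.) -/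
def segment (σ σ' : T) : Set T :=
  {x | ∃ f : ℝ → T, IsGeodesic f σ σ' ∧ x ∈ f '' Icc 0 (dist σ σ')}

variable (T) in
/-- Real trees: any two points are joined by a geodesic, and every injective path runs along
the segment between its end points. -/
structure IsRealTree : Prop where
  exists_geodesic : ∀ σ σ' : T, ∃ f : ℝ → T, IsGeodesic f σ σ'
  image_path : ∀ q : ℝ → T, ContinuousOn q (Icc 0 1) → InjOn q (Icc 0 1) →
    q '' Icc 0 1 = segment (q 0) (q 1)

/-- The set of connected components of `T ∖ {σ}`. -/
def components (σ : T) : Set (Set T) :=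
  {C | ∃ x ∈ ({σ}ᶜ : Set T), C = connectedComponentIn {σ}ᶜ x}

/-- The degree `n(σ)`, in `ℕ ∪ {∞}`. -/
def degree (σ : T) : ℕ∞ := (components σ).encard

/-- The leaves of the tree rooted at `ρ` (the root is never a leaf). -/
def leaves (ρ : T) : Set T := {σ | σ ≠ ρ ∧ degree σ = 1}

/-- The branching points of the tree rooted at `ρ` (the root is never a branching point). -/
def branchPoints (ρ : T) : Set T := {σ | σ ≠ ρ ∧ 3 ≤ degree σ}

/-- `b = σ ∧ σ'`, that is `⟦ρ, b⟧ = ⟦ρ, σ⟧ ∩ ⟦ρ, σ'⟧`. -/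
def IsMeet (ρ σ σ' b : T) : Prop := segment ρ b = segment ρ σ ∩ segment ρ σ'

/-- The connected components of `T ∖ {σ}` that do not contain the root. -/
def childComponents (ρ σ : T) : Set (Set T) := {C | C ∈ components σ ∧ ρ ∉ C}

/-- Pairs `(s, C)` where `s` is a branching point or the root and `C` is a connected component
of `T ∖ {s}` that does not contain the root. -/
def ShuffleIndex (ρ : T) : Type _ :=
  {p : T × Set T // p.1 ∈ branchPoints ρ ∪ {ρ} ∧ p.2 ∈ childComponents ρ p.1}

/-- The order on the tree determined by real labels on the pairs `(s, C)`: `σ` precedes its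
descendants, and if `b = σ ∧ σ'` differs from `σ` and `σ'`, then the components of `T ∖ {b}`
that contain `σ` and `σ'` are compared through their labels. -/
def shuffleLE (ρ : T) (u : ShuffleIndex ρ → ℝ) (σ σ' : T) : Prop :=
  σ ∈ segment ρ σ' ∨
    ∃ b : T, IsMeet ρ σ σ' b ∧ b ≠ σ ∧ b ≠ σ' ∧ ∃ i j : ShuffleIndex ρ,
      i.1.1 = b ∧ j.1.1 = b ∧ σ ∈ i.1.2 ∧ σ' ∈ j.1.2 ∧ u i ≤ u j

/-- The `U i` are independent random variables, uniformly distributed on `[0, 1]`. -/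
structure IsIIDUniform {ι Ω : Type*} [MeasurableSpace Ω] (P : Measure Ω)
    (U : ι → Ω → ℝ) : Prop where
  measurable : ∀ i, Measurable (U i)
  indep : iIndepFun U P
  law : ∀ i, P.map (U i) = volume.restrict (Icc 0 1)

end Trees

/-- Height functions: non-negative functions on `[0, M]`, left-continuous with right limits,
with `h(0) = h(0+) = 0` and `h(t+) ≤ h(t)`. (At `t = M` the condition `right_lim` is void, since
`𝓝[>] t` is the trivial filter there; likewise for `tendsto_zero` if `M = 0`.) -/
structure HeightFunction where
  lifetime : ℝ
  lifetime_nonneg : 0 ≤ lifetime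
  toFun : Icc (0 : ℝ) lifetime → ℝ
  nonneg : ∀ t, 0 ≤ toFun t
  map_zero : toFun ⟨0, left_mem_Icc.2 lifetime_nonneg⟩ = 0
  tendsto_zero : Tendsto toFun (𝓝[>] ⟨0, left_mem_Icc.2 lifetime_nonneg⟩) (𝓝 0)
  left_cont : ∀ t, ContinuousWithinAt toFun (Iic t) t
  right_lim : ∀ t, ∃ l, l ≤ toFun t ∧ Tendsto toFun (𝓝[>] t) (𝓝 l)

namespace HeightFunction

variable (h : HeightFunction)

/-- `m_h(s, t) = inf {h(r) : s ∧ t ≤ r ≤ s ∨ t}`. -/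
def minBetween (s t : Icc (0 : ℝ) h.lifetime) : ℝ := sInf (h.toFun '' uIcc s t)

/-- `d_h(s, t) = h(s) + h(t) - 2 m_h(s, t)`. -/
def timeDist (s t : Icc (0 : ℝ) h.lifetime) : ℝ :=
  h.toFun s + h.toFun t - 2 * h.minBetween s t

lemma bddBelow_image (S : Set (Icc (0 : ℝ) h.lifetime)) : BddBelow (h.toFun '' S) :=
  ⟨0, by rintro _ ⟨r, -, rfl⟩; exact h.nonneg r⟩

lemma minBetween_le {s t r : Icc (0 : ℝ) h.lifetime} (hr : r ∈ uIcc s t) :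
    h.minBetween s t ≤ h.toFun r :=
  csInf_le (h.bddBelow_image _) ⟨r, hr, rfl⟩

lemma le_minBetween {s t : Icc (0 : ℝ) h.lifetime} {a : ℝ}
    (ha : ∀ r ∈ uIcc s t, a ≤ h.toFun r) : a ≤ h.minBetween s t :=
  le_csInf ⟨_, s, left_mem_uIcc, rfl⟩ (by rintro _ ⟨r, hr, rfl⟩; exact ha r hr)

lemma timeDist_self (t : Icc (0 : ℝ) h.lifetime) : h.timeDist t t = 0 := by
  rw [timeDist, minBetween, uIcc_self, image_singleton, csInf_singleton]; ring

lemma timeDist_comm (s t : Icc (0 : ℝ) h.lifetime) : h.timeDist s t = h.timeDist t s := by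
  rw [timeDist, timeDist, minBetween, minBetween, uIcc_comm]; ring

lemma timeDist_triangle (s t u : Icc (0 : ℝ) h.lifetime) :
    h.timeDist s u ≤ h.timeDist s t + h.timeDist t u := by
  have h1 : h.minBetween s t ≤ h.toFun t := h.minBetween_le right_mem_uIcc
  have h2 : h.minBetween t u ≤ h.toFun t := h.minBetween_le left_mem_uIcc
  have h3 : min (h.minBetween s t) (h.minBetween t u) ≤ h.minBetween s u := by
    apply h.le_minBetween
    intro r hr
    rcases uIcc_subset_uIcc_union_uIcc (b := t) hr with hr | hr
    · exact (min_le_left _ _).trans (h.minBetween_le hr)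
    · exact (min_le_right _ _).trans (h.minBetween_le hr)
  simp only [timeDist]
  rcases min_le_iff.1 h3 with h4 | h4 <;> linarith

/-- The time set `[0, M]`, equipped with the pseudo-distance `d_h`. -/
def Time : Type := Icc (0 : ℝ) h.lifetime

instance : PseudoMetricSpace h.Time where
  dist := h.timeDist
  dist_self := h.timeDist_self
  dist_comm := h.timeDist_comm
  dist_triangle := h.timeDist_triangle

/-- The tree `T_h`: the quotient of `[0, M]` by `s ∼ t ↔ d_h(s, t) = 0`, with distance `d_h`. -/
def Tree : Type := SeparationQuotient h.Time

instance : MetricSpace h.Tree := inferInstanceAs (MetricSpace (SeparationQuotient h.Time))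

instance : MeasurableSpace h.Tree := borel _

instance : BorelSpace h.Tree := ⟨rfl⟩

/-- The canonical projection `p_h : [0, M] → T_h`. -/
def proj (t : Icc (0 : ℝ) h.lifetime) : h.Tree := SeparationQuotient.mk (X := h.Time) t

lemma dist_proj (s t : Icc (0 : ℝ) h.lifetime) :
    dist (h.proj s) (h.proj t) = h.timeDist s t := rfl

/-- The root `ρ_h = p_h(0)`. -/
def root : h.Tree := h.proj ⟨0, left_mem_Icc.2 h.lifetime_nonneg⟩

/-- `ℓ(σ) = inf p_h⁻¹({σ})`. -/
def firstVisit (σ : h.Tree) : ℝ := sInf ((↑) '' (h.proj ⁻¹' {σ}))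

/-- The order `≤_h` on `T_h`. -/
def treeLE (σ σ' : h.Tree) : Prop := h.firstVisit σ ≤ h.firstVisit σ'

lemma eventually_dist_proj_lt (t : Icc (0 : ℝ) h.lifetime) {ε : ℝ} (hε : 0 < ε) :
    ∀ᶠ s in 𝓝[≤] t, dist (h.proj s) (h.proj t) < ε := by
  have hev : ∀ᶠ s in 𝓝[≤] t, |h.toFun s - h.toFun t| < ε / 4 :=
    (Metric.tendsto_nhds.1 (h.left_cont t)) (ε / 4) (by linarith)
  have hev' : ∀ᶠ s in 𝓝[≤] t, ∀ r ∈ Icc s t, |h.toFun r - h.toFun t| < ε / 4 := by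
    by_cases hb : ∃ a, a < t
    · obtain ⟨a, ha, hsub⟩ := (mem_nhdsLE_iff_exists_Ioc_subset' hb.choose_spec).1 hev
      filter_upwards [Ioc_mem_nhdsLE ha] with s hs r hr
      exact hsub ⟨hs.1.trans_le hr.1, hr.2⟩
    · push Not at hb
      have : ∀ᶠ s in 𝓝[≤] t, s ∈ Iic t := self_mem_nhdsWithin
      filter_upwards [this] with s hs r hr
      have : r = t := le_antisymm hr.2 (hb r)
      simp [this, hε]
  filter_upwards [hev', self_mem_nhdsWithin] with s hs hst
  have hst : s ≤ t := hst
  rw [dist_proj, timeDist]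
  have h1 := abs_lt.1 (hs s ⟨le_rfl, hst⟩)
  have h2 : h.toFun t - ε / 4 ≤ h.minBetween s t := by
    apply h.le_minBetween
    intro r hr
    rw [uIcc_of_le hst] at hr
    have := abs_lt.1 (hs r hr)
    linarith
  linarith

lemma measurable_proj : Measurable h.proj := by
  refine measurable_of_isOpen fun V hV => ?_
  set W := h.proj ⁻¹' V with hW
  have key : ∀ t ∈ W, (∃ a, a < t) → ∃ a, a < t ∧ Ioc a t ⊆ W := by
    intro t ht ha
    obtain ⟨ε, hε, hball⟩ := Metric.isOpen_iff.1 hV _ ht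
    have : ∀ᶠ s in 𝓝[≤] t, s ∈ W := by
      filter_upwards [h.eventually_dist_proj_lt t hε] with s hs
      exact hball hs
    obtain ⟨a, ha, hsub⟩ := (mem_nhdsLE_iff_exists_Ioc_subset' ha.choose_spec).1 this
    exact ⟨a, ha, hsub⟩
  let Z : Set (Icc (0 : ℝ) h.lifetime) := {t | t ∈ W ∧ t ∉ interior W ∧ ∃ a, a < t}
  have hZ : Z.Countable := by
    have hch : ∀ t : Icc (0 : ℝ) h.lifetime, ∃ a, t ∈ Z → a < t ∧ Ioc a t ⊆ W := by
      intro t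
      by_cases ht : t ∈ Z
      · obtain ⟨a, ha⟩ := key t ht.1 ht.2.2
        exact ⟨a, fun _ => ha⟩
      · exact ⟨t, fun h' => absurd h' ht⟩
    choose y hy using hch
    have hint : ∀ t ∈ Z, Ioo (y t) t ⊆ interior W := fun t ht =>
      interior_maximal (Ioo_subset_Ioc_self.trans (hy t ht).2) isOpen_Ioo
    have hlt : ∀ s ∈ Z, ∀ t ∈ Z, s < t → Disjoint (Ioo (y s) s) (Ioo (y t) t) := by
      intro s hs t ht hst
      have : s ≤ y t := by
        by_contra hc
        exact hs.2.1 (hint t ht ⟨not_le.1 hc, hst⟩)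
      rw [Set.disjoint_left]
      intro x hx hx'
      exact absurd (hx.2.trans_le this) (not_lt.2 hx'.1.le)
    refine Set.PairwiseDisjoint.countable_of_isOpen (s := fun t => Ioo (y t) t) ?_
      (fun _ _ => isOpen_Ioo) (fun t ht => nonempty_Ioo.2 (hy t ht).1)
    intro s hs t ht hne
    rcases lt_or_gt_of_ne hne with hst | hst
    · exact hlt s hs t ht hst
    · exact (hlt t ht s hs hst).symm
  let B : Set (Icc (0 : ℝ) h.lifetime) := {t | t ∈ W ∧ ∀ a, t ≤ a}
  have hB : B.Subsingleton := fun s hs t ht => le_antisymm (hs.2 t) (ht.2 s)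
  have hWeq : W = interior W ∪ Z ∪ B := by
    ext t
    constructor
    · intro ht
      by_cases h1 : t ∈ interior W
      · exact Or.inl (Or.inl h1)
      · by_cases h2 : ∃ a, a < t
        · exact Or.inl (Or.inr ⟨ht, h1, h2⟩)
        · push Not at h2
          exact Or.inr ⟨ht, h2⟩
    · rintro ((ht | ht) | ht)
      · exact interior_subset ht
      · exact ht.1
      · exact ht.1
  rw [hWeq]
  exact (isOpen_interior.measurableSet.union hZ.measurableSet).union hB.measurableSet

/-- The measure `μ_h` on `T_h`: the image of the Lebesgue measure on `[0, M]` by `p_h`. -/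
def treeMeasure : Measure h.Tree :=
  (Measure.comap ((↑) : Icc (0 : ℝ) h.lifetime → ℝ) volume).map h.proj

/-- `r(σ) = inf {t > ℓ(σ) : p_h(t) ≠ σ}`, with the infimum taken within `[0, M]`, so that it is
`M` if there is no such `t`. -/
def firstExit (σ : h.Tree) : ℝ :=
  sInf ((↑) '' {t : Icc (0 : ℝ) h.lifetime | h.firstVisit σ < t ∧ h.proj t ≠ σ} ∪ {h.lifetime})

/-- The set `F(h)` of times of first visit. -/
def firstVisitTimes : Set ℝ := ⋃ σ : h.Tree, Icc (h.firstVisit σ) (h.firstExit σ)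

/-- Condition (Min): the set `S(h) = [0, M] ∖ F(h)` of times of latter visit is Lebesgue-null. -/
def IsMinimal : Prop := volume (Icc 0 h.lifetime \ h.firstVisitTimes) = 0

end HeightFunction

/-- Equivalence of structured trees: there is an isometry from `T` onto `T'` that preserves the
roots, the orders and the measures. (If the orders are linear, the condition on the orders says
that `f` is non-decreasing.) -/
def StructuredEquiv {T T' : Type*} [MetricSpace T] [MeasurableSpace T] [MetricSpace T']
    [MeasurableSpace T'] (ρ : T) (r : T → T → Prop) (μ : Measure T)
    (ρ' : T') (r' : T' → T' → Prop) (μ' : Measure T') : Prop :=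
  ∃ f : T ≃ᵢ T', f ρ = ρ' ∧ (∀ σ₁ σ₂, r σ₁ σ₂ ↔ r' (f σ₁) (f σ₂)) ∧ μ' = μ.map f

/-- `h` is a minimal height function coding the structured tree `(T, d, ρ, r, μ)`. -/
def IsCodingHeight {T : Type*} [MetricSpace T] [MeasurableSpace T] (ρ : T) (r : T → T → Prop)
    (μ : Measure T) (h : HeightFunction) : Prop :=
  h.IsMinimal ∧ StructuredEquiv ρ r μ h.root h.treeLE h.treeMeasure

end RealTree

end

/-! Dense leaves force infinitely many side branches off every segment from an ancestor to a
descendant. Their labels are independent, so by Borel-Cantelli almost surely each such segment has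
side branches ordered before its far end and others ordered after it (`IsRealTree.ae_isPlaneOrder`);
countably many pairs of branching points suffice. The rest is deterministic and uses only
`IsPlaneOrder`, so the exceptional event does not depend on `μ`.

Existence: give each point `x` the time interval that starts at the mass strictly before `x` and has
length `μ {x}`. A non-empty open set lies, in the order, between any two distinct points, and `μ`
charges it, so the intervals are disjoint and ordered like the points. By compactness, points at
distance at least `ε` own intervals at least `δ` apart (`exists_uniform_separation`). Spreading each
atom uniformly over its interval turns `μ` into Lebesgue measure (`map_spread`), so the intervals
are dense in time, and the map from times to points extends to a continuous path (`exists_contour`).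
Subtrees are order-convex, so the path stays above `c` between two times when it is above `c`; hence
its height codes the tree (`IsContour.isCodingHeight`).

Uniqueness: minimality forces any coding height function to visit `x` first at the mass strictly
before `x`. At almost every time its value is then the distance from the root to the point owning
that time (`IsCodingHeight.ae_toFun_eq`), and left-continuity removes the null set. Continuity is
inherited from the path. -/

set_option linter.unusedSectionVars false

noncomputable section

namespace RealTree

/-! ### Real trees through metric betweenness -/

section MetricTree

variable {T : Type*} [MetricSpace T]

/-- `x` lies metrically between `a` and `b`. -/
def Btw (a x b : T) : Prop := dist a x + dist x b = dist a b

lemma btw_left (a b : T) : Btw a a b := by simp [Btw]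

lemma btw_right (a b : T) : Btw a b b := by simp [Btw]

lemma Btw.symm {a x b : T} (h : Btw a x b) : Btw b x a := by
  unfold Btw at *
  rw [dist_comm b x, dist_comm x a, dist_comm b a]; linarith

lemma Btw.dist_le {a x b : T} (h : Btw a x b) : dist a x ≤ dist a b := by
  unfold Btw at h; linarith [dist_nonneg (x := x) (y := b)]

lemma Btw.trans {a x y b : T} (hx : Btw a x y) (hy : Btw a y b) : Btw a x b := by
  unfold Btw at *
  linarith [dist_triangle x y b, dist_triangle a x b]

lemma Btw.trans_right {a x y b : T} (hx : Btw a x y) (hy : Btw a y b) : Btw x y b := by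
  unfold Btw at *
  linarith [dist_triangle x y b, dist_triangle a x b]

lemma Btw.antisymm {a x y : T} (hx : Btw a x y) (hy : Btw a y x) : x = y := by
  unfold Btw at *
  rw [dist_comm y x] at hy
  exact dist_le_zero.1 (by linarith)

lemma Btw.eq_of_dist_le {a x y : T} (hx : Btw a x y) (hy : dist a y ≤ dist a x) : x = y := by
  unfold Btw at *
  exact dist_le_zero.1 (by linarith)

lemma Btw.dist_lt {a x y : T} (hx : Btw a x y) (hne : x ≠ y) : dist a x < dist a y :=
  lt_of_not_ge fun hle => hne (hx.eq_of_dist_le hle)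

lemma btw_self {a x : T} (h : Btw a x a) : x = a := (h.eq_of_dist_le (by simp))

lemma isClosed_btw (a c : T) : IsClosed {y | Btw a c y} :=
  isClosed_eq (by fun_prop) (by fun_prop)

lemma isClosed_btw_mid (a c : T) : IsClosed {y | Btw a y c} :=
  isClosed_eq (by fun_prop) (by fun_prop)

/-- The concatenation of two paths at time `a`. -/
def glue (f g : ℝ → T) (a : ℝ) (t : ℝ) : T := if t ≤ a then f t else g (t - a)

lemma IsGeodesic.btw {f : ℝ → T} {a b : T} (hf : IsGeodesic f a b) {t : ℝ}
    (ht : t ∈ Icc 0 (dist a b)) : dist a (f t) = t ∧ Btw a (f t) b := by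
  obtain ⟨h0, h1, h2⟩ := hf
  have e1 := h2 0 ⟨le_rfl, dist_nonneg⟩ t ht
  have e2 := h2 t ht (dist a b) ⟨dist_nonneg, le_rfl⟩
  rw [h0, zero_sub, abs_neg, abs_of_nonneg ht.1] at e1
  rw [h1, abs_sub_comm, abs_of_nonneg (by linarith [ht.2])] at e2
  exact ⟨e1, by unfold Btw; linarith⟩

lemma glue_apply_left {f g : ℝ → T} {a t : ℝ} (h : t ≤ a) : glue f g a t = f t := if_pos h

lemma glue_apply_right {x m y : T} {f g : ℝ → T} (hf : IsGeodesic f x m) (hg : IsGeodesic g m y)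
    {t : ℝ} (h : dist x m ≤ t) : glue f g (dist x m) t = g (t - dist x m) := by
  rcases h.eq_or_lt with h | h
  · subst h; rw [glue_apply_left le_rfl, hf.2.1, sub_self, hg.1]
  · exact if_neg (not_le.2 h)

lemma dist_glue_le {x m y : T} {f g : ℝ → T} (hf : IsGeodesic f x m) (hg : IsGeodesic g m y)
    {s t : ℝ} (hs : 0 ≤ s) (hst : s ≤ t) (ht : t ≤ dist x m + dist m y) :
    dist (glue f g (dist x m) s) (glue f g (dist x m) t) ≤ t - s := by
  rcases le_total t (dist x m) with h | h
  · rw [glue_apply_left h, glue_apply_left (hst.trans h),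
      hf.2.2 s ⟨hs, hst.trans h⟩ t ⟨hs.trans hst, h⟩, abs_sub_comm, abs_of_nonneg (by linarith)]
  · rcases le_total s (dist x m) with h' | h'
    · rw [glue_apply_left h', glue_apply_right hf hg h]
      have e1 := (hf.btw (t := s) ⟨hs, h'⟩)
      have e2 := (hg.btw (t := t - dist x m) ⟨by linarith, by linarith⟩)
      have := dist_triangle (f s) m (g (t - dist x m))
      have e3 := e1.2
      unfold Btw at e3
      linarith [e1.1, e2.1]
    · rw [glue_apply_right hf hg h', glue_apply_right hf hg h,
        hg.2.2 _ ⟨by linarith, by linarith⟩ _ ⟨by linarith, by linarith⟩, abs_sub_comm,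
        abs_of_nonneg (by linarith)]
      linarith

/-- A 1-Lipschitz path whose duration equals the distance of its end points cannot lose length
anywhere, so it is a geodesic. -/
lemma isGeodesic_glue {x m y : T} {f g : ℝ → T} (hf : IsGeodesic f x m) (hg : IsGeodesic g m y)
    (h : Btw x m y) : IsGeodesic (glue f g (dist x m)) x y := by
  have h' := h
  unfold Btw at h
  have h0 : glue f g (dist x m) 0 = x := by rw [glue_apply_left dist_nonneg, hf.1]
  have h1 : glue f g (dist x m) (dist x y) = y := by
    rw [glue_apply_right hf hg h'.dist_le, ← h, add_sub_cancel_left, hg.2.1]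
  have key : ∀ s t, 0 ≤ s → s ≤ t → t ≤ dist x y →
      dist (glue f g (dist x m) s) (glue f g (dist x m) t) = t - s := by
    intro s t hs hst ht
    refine le_antisymm (dist_glue_le hf hg hs hst (by linarith)) ?_
    have a1 := dist_glue_le hf hg le_rfl hs (by linarith)
    have a2 := dist_glue_le hf hg (hs.trans hst) ht (by linarith)
    rw [h0] at a1
    rw [h1] at a2
    have := dist_triangle4 x (glue f g (dist x m) s) (glue f g (dist x m) t) y
    linarith
  refine ⟨h0, h1, fun s hs t ht => ?_⟩
  rcases le_total s t with hst | hst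
  · rw [key s t hs.1 hst ht.2, abs_sub_comm, abs_of_nonneg (by linarith)]
  · rw [dist_comm, key t s ht.1 hst hs.2, abs_of_nonneg (by linarith)]

variable (hT : IsRealTree T)
include hT

lemma IsRealTree.exists_geodesic_through {a x b : T} (h : Btw a x b) :
    ∃ f, IsGeodesic f a b ∧ f (dist a x) = x := by
  obtain ⟨f, hf⟩ := hT.exists_geodesic a x
  obtain ⟨g, hg⟩ := hT.exists_geodesic x b
  exact ⟨_, isGeodesic_glue hf hg h, by rw [glue_apply_left le_rfl, hf.2.1]⟩

lemma IsRealTree.mem_segment {a x b : T} : x ∈ segment a b ↔ Btw a x b := by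
  constructor
  · rintro ⟨f, hf, t, ht, rfl⟩
    exact (hf.btw ht).2
  · intro h
    obtain ⟨f, hf, hx⟩ := hT.exists_geodesic_through h
    exact ⟨f, hf, dist a x, ⟨dist_nonneg, h.dist_le⟩, hx⟩

/-- The path axiom, rescaled from the unit interval to the form in which it is applied to geodesics
and their concatenations. -/
lemma IsRealTree.image_eq_segment {p : ℝ → T} {D : ℝ} (hD : 0 < D)
    (hp : ∀ s t, 0 ≤ s → s ≤ t → t ≤ D → dist (p s) (p t) ≤ t - s) (hinj : InjOn p (Icc 0 D)) :
    p '' Icc 0 D = segment (p 0) (p D) := by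
  have hmaps : MapsTo (fun s : ℝ => s * D) (Icc 0 1) (Icc 0 D) := fun s hs =>
    ⟨mul_nonneg hs.1 hD.le, by nlinarith [hs.2]⟩
  have himg : (fun s : ℝ => s * D) '' Icc 0 1 = Icc 0 D := by
    refine hmaps.image_subset.antisymm fun s hs => ⟨s / D, ⟨div_nonneg hs.1 hD.le, ?_⟩, ?_⟩
    · exact (div_le_one hD).2 hs.2
    · simp [hD.ne']
  have hcont : ContinuousOn p (Icc 0 D) := by
    refine LipschitzOnWith.continuousOn (K := 1) (LipschitzOnWith.of_dist_le_mul ?_)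
    intro s hs t ht
    rw [NNReal.coe_one, one_mul, Real.dist_eq]
    rcases le_total s t with hst | hst
    · rw [abs_sub_comm]; exact (hp s t hs.1 hst ht.2).trans (le_abs_self _)
    · rw [dist_comm]; exact (hp t s ht.1 hst hs.2).trans (le_abs_self _)
  have := hT.image_path (fun s => p (s * D))
    (hcont.comp (by fun_prop) hmaps)
    (hinj.comp (fun s _ t _ h => by simpa [hD.ne'] using h) hmaps)
  simp only [zero_mul, one_mul] at this
  rw [← this, ← himg, image_image]

/-- Uniqueness of geodesics: by the path axiom a single geodesic through `x` already covers the
whole segment, hence meets `y`, and its points are determined by their distance to `a`. -/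
lemma IsRealTree.btw_unique {a x y b : T} (hx : Btw a x b) (hy : Btw a y b)
    (h : dist a x = dist a y) : x = y := by
  obtain ⟨f, hf, hfx⟩ := hT.exists_geodesic_through hx
  rcases (dist_nonneg (x := a) (y := b)).eq_or_lt with h0 | h0
  · have e1 := hx.dist_le
    have e2 := hy.dist_le
    rw [← h0] at e1 e2
    rw [← dist_le_zero.1 e1, ← dist_le_zero.1 e2]
  · have himg := hT.image_eq_segment (p := f) h0
      (fun s t hs hst ht => by
        rw [hf.2.2 s ⟨hs, hst.trans ht⟩ t ⟨hs.trans hst, ht⟩, abs_sub_comm,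
          abs_of_nonneg (by linarith)])
      (fun s hs t ht hst => by
        rw [← (hf.btw hs).1, ← (hf.btw ht).1, hst])
    rw [hf.1, hf.2.1] at himg
    have : y ∈ f '' Icc 0 (dist a b) := himg ▸ hT.mem_segment.2 hy
    obtain ⟨s, hs, rfl⟩ := this
    rw [← hfx, h, (hf.btw hs).1]

/-- Two geodesics that share only `m` concatenate to an injective path, so the path axiom puts `m`
on the segment of the end points. This is where the absence of loops enters. -/
lemma IsRealTree.btw_of_inter {x m y : T} (h : ∀ z, Btw x z m → Btw m z y → z = m) :
    Btw x m y := by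
  obtain ⟨f, hf⟩ := hT.exists_geodesic x m
  obtain ⟨g, hg⟩ := hT.exists_geodesic m y
  rcases (add_nonneg (dist_nonneg (x := x) (y := m)) (dist_nonneg (x := m) (y := y))).eq_or_lt
    with h0 | h0
  · have : dist x m = 0 := by
      linarith [dist_nonneg (x := x) (y := m), dist_nonneg (x := m) (y := y)]
    rw [dist_eq_zero] at this
    subst this; exact btw_left _ _
  · have key : ∀ s t, 0 ≤ s → s ≤ t → t ≤ dist x m + dist m y →
        glue f g (dist x m) s = glue f g (dist x m) t → s = t := by
      intro s t hs hst ht hq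
      rcases le_total t (dist x m) with h | h'
      · rw [glue_apply_left h, glue_apply_left (hst.trans h)] at hq
        rw [← (hf.btw ⟨hs, hst.trans h⟩).1, ← (hf.btw ⟨hs.trans hst, h⟩).1, hq]
      · rw [glue_apply_right hf hg h'] at hq
        have b2 := hg.btw (t := t - dist x m) ⟨by linarith, by linarith⟩
        rcases le_total s (dist x m) with h'' | h''
        · rw [glue_apply_left h''] at hq
          have b1 := hf.btw ⟨hs, h''⟩
          rw [hq] at b1
          have := h _ b1.2 b2.2
          rw [this] at b1 b2
          have b3 := b2.1
          rw [dist_self] at b3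
          linarith [b1.1]
        · rw [glue_apply_right hf hg h''] at hq
          have b1 := hg.btw (t := s - dist x m) ⟨by linarith, by linarith⟩
          have := b1.1.symm.trans ((congrArg _ hq).trans b2.1)
          linarith
    have himg := hT.image_eq_segment (p := glue f g (dist x m)) h0
      (fun s t => dist_glue_le hf hg)
      (fun s hs t ht hst => by
        rcases le_total s t with hle | hle
        · exact key s t hs.1 hle ht.2 hst
        · exact (key t s ht.1 hle hs.2 hst.symm).symm)
    rw [glue_apply_left dist_nonneg, hf.1,
      glue_apply_right hf hg (by linarith [dist_nonneg (x := m) (y := y)]),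
      add_sub_cancel_left, hg.2.1] at himg
    rw [← hT.mem_segment, ← himg]
    exact ⟨dist x m, ⟨dist_nonneg, by linarith [dist_nonneg (x := m) (y := y)]⟩,
      by rw [glue_apply_left le_rfl, hf.2.1]⟩

lemma IsRealTree.exists_btw (a b : T) {t : ℝ} (ht : t ∈ Icc 0 (dist a b)) :
    ∃ x, Btw a x b ∧ dist a x = t := by
  obtain ⟨f, hf⟩ := hT.exists_geodesic a b
  exact ⟨f t, (hf.btw ht).2, (hf.btw ht).1⟩

lemma IsRealTree.btw_of_le {a x y b : T} (hx : Btw a x b) (hy : Btw a y b)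
    (h : dist a x ≤ dist a y) : Btw a x y := by
  obtain ⟨z, hz, hzd⟩ := hT.exists_btw a y (t := dist a x) ⟨dist_nonneg, h⟩
  rwa [← hT.btw_unique (hz.trans hy) hx hzd]

lemma IsRealTree.btw_total {a x y b : T} (hx : Btw a x b) (hy : Btw a y b) :
    Btw a x y ∨ Btw a y x :=
  (le_total (dist a x) (dist a y)).imp (hT.btw_of_le hx hy) (hT.btw_of_le hy hx)

lemma IsRealTree.exists_btw_strict {a b : T} (h : a ≠ b) : ∃ x, Btw a x b ∧ x ≠ a ∧ x ≠ b := by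
  have hd : 0 < dist a b := dist_pos.2 h
  obtain ⟨x, hx, hxd⟩ := hT.exists_btw a b (t := dist a b / 2) ⟨by linarith, by linarith⟩
  refine ⟨x, hx, ?_, ?_⟩
  · rintro rfl; rw [dist_self] at hxd; linarith
  · rintro rfl; linarith

/-- The common part of the two segments is compact, and `m` is its point farthest from `a`. Beyond
`m` the segments are disjoint, so `btw_of_inter` applies. -/
lemma IsRealTree.exists_meet (a x y : T) : ∃ m, Btw a m x ∧ Btw a m y ∧ Btw x m y ∧
    ∀ z, Btw a z x → Btw a z y → Btw a z m := by
  obtain ⟨f, hf⟩ := hT.exists_geodesic a x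
  obtain ⟨g, hg⟩ := hT.exists_geodesic a y
  let A : Set T := {z | Btw a z x} ∩ {z | Btw a z y}
  have hA : IsClosed A := (isClosed_btw_mid a x).inter (isClosed_btw_mid a y)
  have hAc : IsCompact A := by
    have hfc : ContinuousOn f (Icc 0 (dist a x)) := by
      refine LipschitzOnWith.continuousOn (K := 1) (LipschitzOnWith.of_dist_le_mul ?_)
      intro s hs t ht
      rw [NNReal.coe_one, one_mul, Real.dist_eq, hf.2.2 s hs t ht]
    refine (isCompact_Icc.image_of_continuousOn hfc).of_isClosed_subset hA ?_
    rintro z ⟨hz, -⟩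
    have hmem : dist a z ∈ Icc 0 (dist a x) := ⟨dist_nonneg, hz.dist_le⟩
    exact ⟨dist a z, hmem, hT.btw_unique (hf.btw hmem).2 hz (hf.btw hmem).1⟩
  obtain ⟨m, hm, hmax⟩ := hAc.exists_isMaxOn ⟨a, btw_left _ _, btw_left _ _⟩
    (f := fun z => dist a z) (by fun_prop)
  have hle : ∀ z, Btw a z x → Btw a z y → Btw a z m := fun z hz hz' =>
    hT.btw_of_le hz hm.1 (hmax ⟨hz, hz'⟩)
  refine ⟨m, hm.1, hm.2, hT.btw_of_inter fun z hz hz' => ?_, hle⟩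
  have h1 : Btw x z a := hz.trans hm.1.symm
  have h2 : Btw y z a := hz'.symm.trans hm.2.symm
  have h3 := hle z h1.symm h2.symm
  have h4 : Btw a m z := (hz.trans_right hm.1.symm).symm
  exact h3.antisymm h4

/-- The point where the segments from `a` to `x` and from `a` to `y` separate. -/
def IsRealTree.meet (a x y : T) : T := (hT.exists_meet a x y).choose

lemma IsRealTree.meet_left (a x y : T) : Btw a (hT.meet a x y) x :=
  (hT.exists_meet a x y).choose_spec.1

lemma IsRealTree.meet_right (a x y : T) : Btw a (hT.meet a x y) y :=
  (hT.exists_meet a x y).choose_spec.2.1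

lemma IsRealTree.btw_meet (a x y : T) : Btw x (hT.meet a x y) y :=
  (hT.exists_meet a x y).choose_spec.2.2.1

lemma IsRealTree.le_meet {a x y z : T} (h : Btw a z x) (h' : Btw a z y) :
    Btw a z (hT.meet a x y) :=
  (hT.exists_meet a x y).choose_spec.2.2.2 z h h'

lemma IsRealTree.meet_eq {a x y m : T} (h1 : Btw a m x) (h2 : Btw a m y)
    (h3 : ∀ z, Btw a z x → Btw a z y → Btw a z m) : hT.meet a x y = m :=
  (h3 _ (hT.meet_left _ _ _) (hT.meet_right _ _ _)).antisymm (hT.le_meet h1 h2)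

lemma IsRealTree.meet_comm (a x y : T) : hT.meet a x y = hT.meet a y x :=
  hT.meet_eq (hT.meet_right _ _ _) (hT.meet_left _ _ _) fun _ h h' => hT.le_meet h' h

lemma IsRealTree.meet_eq_left {a x y : T} (h : Btw a x y) : hT.meet a x y = x :=
  hT.meet_eq (btw_right _ _) h fun _ h _ => h

lemma IsRealTree.isMeet_iff {a x y b : T} : IsMeet a x y b ↔ b = hT.meet a x y := by
  unfold IsMeet
  simp only [Set.ext_iff, mem_inter_iff, hT.mem_segment]
  constructor
  · intro h
    have hb := (h b).1 (btw_right _ _)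
    exact (hT.meet_eq hb.1 hb.2 fun z h1 h2 => (h z).2 ⟨h1, h2⟩).symm
  · rintro rfl z
    exact ⟨fun h => ⟨h.trans (hT.meet_left _ _ _), h.trans (hT.meet_right _ _ _)⟩,
      fun h => hT.le_meet h.1 h.2⟩

/-- A point `w` closer to `z` than `c` lies on the same side of `c` as `z`. -/
lemma IsRealTree.btw_of_dist_lt {a c z w : T} (h : Btw a c z) (hw : dist z w < dist c z) :
    Btw a c w ∧ w ≠ c := by
  refine ⟨?_, by rintro rfl; rw [dist_comm] at hw; exact hw.false⟩
  have h1 := hT.meet_left a z w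
  have h2 := hT.meet_right a z w
  have h3 := hT.btw_meet a z w
  refine (hT.btw_of_le h h1 ?_).trans h2
  unfold Btw at *
  rw [dist_comm z] at h3
  linarith [dist_nonneg (x := hT.meet a z w) (y := w)]

lemma IsRealTree.isOpen_btw (a c : T) : IsOpen {y | Btw a c y ∧ y ≠ c} := by
  rw [Metric.isOpen_iff]
  rintro z ⟨hz, hne⟩
  refine ⟨dist c z, dist_pos.2 hne.symm, fun w hw => ?_⟩
  exact hT.btw_of_dist_lt hz (by rwa [Metric.mem_ball, dist_comm] at hw)

lemma IsRealTree.isPreconnected_btw (a b : T) : IsPreconnected {x | Btw a x b} := by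
  obtain ⟨f, hf⟩ := hT.exists_geodesic a b
  have hfc : ContinuousOn f (Icc 0 (dist a b)) := by
    refine LipschitzOnWith.continuousOn (K := 1) (LipschitzOnWith.of_dist_le_mul ?_)
    intro s hs t ht
    rw [NNReal.coe_one, one_mul, Real.dist_eq, hf.2.2 s hs t ht]
  have : {x | Btw a x b} = f '' Icc 0 (dist a b) := by
    ext z
    constructor
    · intro hz
      have hmem : dist a z ∈ Icc 0 (dist a b) := ⟨dist_nonneg, Btw.dist_le hz⟩
      exact ⟨dist a z, hmem, hT.btw_unique (hf.btw hmem).2 hz (hf.btw hmem).1⟩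
    · rintro ⟨t, ht, rfl⟩; exact (hf.btw ht).2
  rw [this]
  exact isPreconnected_Icc.image _ hfc

/-- A connected set contains the segments between its points. -/
lemma IsRealTree.mem_of_isPreconnected {S : Set T} (hS : IsPreconnected S) {x y c : T}
    (hx : x ∈ S) (hy : y ∈ S) (hc : Btw x c y) : c ∈ S := by
  by_contra hcS
  have h1 : IsOpen {z | Btw x c z}ᶜ := (isClosed_btw x c).isOpen_compl
  obtain ⟨z, -, hz, hz'⟩ := hS _ _ h1 (hT.isOpen_btw x c)
    (fun z hz => by
      by_cases h : Btw x c z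
      · exact Or.inr ⟨h, fun h' => hcS (h' ▸ hz)⟩
      · exact Or.inl h)
    ⟨x, hx, fun h => hcS ((btw_self h) ▸ hx)⟩ ⟨y, hy, hc, fun h => hcS (h ▸ hy)⟩
  exact hz hz'.1

lemma IsRealTree.connectedComponentIn_compl {b x : T} (h : x ≠ b) :
    connectedComponentIn {b}ᶜ x = {y | ¬ Btw x b y} := by
  apply Subset.antisymm
  · intro y hy hb
    exact connectedComponentIn_subset _ _ (hT.mem_of_isPreconnected
      isPreconnected_connectedComponentIn (mem_connectedComponentIn h) hy hb) rfl
  · intro y hy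
    refine (hT.isPreconnected_btw x y).subset_connectedComponentIn (btw_left _ _) ?_
      (btw_right _ _)
    rintro z hz rfl
    exact hy hz

end MetricTree

/-! ### Components of the complement of a point, branching points, leaves -/

section Components

variable {T : Type*} [MetricSpace T]

/-- The component of `x` in the complement of `b`, for a real tree. -/
def comp (b x : T) : Set T := {y | ¬ Btw x b y}

lemma isOpen_comp (b x : T) : IsOpen (comp b x) := (isClosed_btw x b).isOpen_compl

lemma mem_comp_self {b x : T} (h : x ≠ b) : x ∈ comp b x := fun h' => h (btw_self h').symm

lemma ne_of_mem_comp {b x y : T} (h : y ∈ comp b x) : y ≠ b := by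
  rintro rfl; exact h (btw_right _ _)

variable (hT : IsRealTree T)
include hT

lemma IsRealTree.comp_eq {b x y : T} (hx : x ≠ b) (h : y ∈ comp b x) : comp b x = comp b y := by
  have hy := ne_of_mem_comp h
  have := hT.connectedComponentIn_compl hx
  unfold comp at *
  rw [← this] at h ⊢
  rw [connectedComponentIn_eq h, hT.connectedComponentIn_compl hy]

lemma IsRealTree.mem_components {b : T} {C : Set T} :
    C ∈ components b ↔ ∃ x, x ≠ b ∧ C = comp b x := by
  constructor
  · rintro ⟨x, hx, rfl⟩
    exact ⟨x, hx, hT.connectedComponentIn_compl hx⟩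
  · rintro ⟨x, hx, rfl⟩
    exact ⟨x, hx, (hT.connectedComponentIn_compl hx).symm⟩

lemma IsRealTree.mem_childComponents {ρ b : T} {C : Set T} :
    C ∈ childComponents ρ b ↔ ∃ x, x ≠ b ∧ Btw ρ b x ∧ C = comp b x := by
  simp only [childComponents, mem_ofPred_eq, hT.mem_components]
  constructor
  · rintro ⟨⟨x, hx, rfl⟩, h⟩
    exact ⟨x, hx, (not_not.1 h).symm, rfl⟩
  · rintro ⟨x, hx, h, rfl⟩
    exact ⟨⟨x, hx, rfl⟩, fun h' => h' h.symm⟩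

/-- Translates components into genealogy: `x` and `y` share a component above `b` when their
lineages separate strictly after `b`. -/
lemma IsRealTree.mem_comp_iff {ρ b x y : T} (hb : Btw ρ b x) :
    y ∈ comp b x ↔ Btw ρ b (hT.meet ρ x y) ∧ hT.meet ρ x y ≠ b := by
  have h1 := hT.meet_left ρ x y
  have h2 := hT.meet_right ρ x y
  have h3 := hT.btw_meet ρ x y
  set m := hT.meet ρ x y
  constructor
  · intro hy
    have hne : m ≠ b := fun h => hy (h ▸ h3)
    refine ⟨(hT.btw_total hb h1).resolve_right fun h => hy ?_, hne⟩
    exact (h.trans_right hb).symm.trans h3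
  · rintro ⟨hbm, hne⟩ hy
    have e1 := (hbm.trans_right h1)
    have e2 := (hbm.trans_right h2)
    apply hne
    unfold Btw at *
    rw [dist_comm x] at h3 hy
    have := dist_nonneg (x := b) (y := m)
    exact dist_le_zero.1 (by rw [dist_comm]; linarith)

lemma IsRealTree.btw_of_mem_comp {ρ b x y : T} (hb : Btw ρ b x) (h : y ∈ comp b x) :
    Btw ρ b y := ((hT.mem_comp_iff hb).1 h).1.trans (hT.meet_right ρ x y)

lemma IsRealTree.mem_comp_of_btw {ρ b c x y : T} (hb : Btw ρ b c) (hne : c ≠ b) (hx : Btw ρ c x)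
    (hy : Btw ρ c y) : y ∈ comp b x := by
  have h := hT.le_meet hx hy
  refine (hT.mem_comp_iff (hb.trans hx)).2 ⟨hb.trans h, ?_⟩
  rintro h'
  rw [h'] at h
  exact hne (h.antisymm hb)

lemma IsRealTree.mem_branchPoints {ρ b x y : T} (hb : b ≠ ρ) (hx : Btw ρ b x) (hy : Btw ρ b y)
    (hxb : x ≠ b) (hyb : y ≠ b) (hxy : Btw x b y) : b ∈ branchPoints ρ := by
  refine ⟨hb, ?_⟩
  have hsub : ({comp b ρ, comp b x, comp b y} : Set (Set T)) ⊆ components b := by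
    rintro C (rfl | rfl | rfl)
    · exact hT.mem_components.2 ⟨ρ, hb.symm, rfl⟩
    · exact hT.mem_components.2 ⟨x, hxb, rfl⟩
    · exact hT.mem_components.2 ⟨y, hyb, rfl⟩
  have h1 : comp b ρ ≠ comp b x := fun h => (h ▸ mem_comp_self hxb : x ∈ comp b ρ) hx
  have h2 : comp b ρ ≠ comp b y := fun h => (h ▸ mem_comp_self hyb : y ∈ comp b ρ) hy
  have h3 : comp b x ≠ comp b y := fun h => (h ▸ mem_comp_self hyb : y ∈ comp b x) hxy
  have : ({comp b ρ, comp b x, comp b y} : Set (Set T)).encard = 3 := by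
    rw [Set.encard_insert_of_notMem (by simp [h1, h2]), Set.encard_pair h3]; norm_num
  rw [← this]
  exact encard_le_encard hsub

lemma IsRealTree.eq_of_mem_leaves {ρ l y : T} (hl : l ∈ leaves ρ) (h : Btw ρ l y) : l = y := by
  by_contra hne
  have hcard : 1 < degree l := by
    refine one_lt_encard_iff.2 ⟨comp l ρ, comp l y, hT.mem_components.2 ⟨ρ, hl.1.symm, rfl⟩,
      hT.mem_components.2 ⟨y, fun h => hne h.symm, rfl⟩, fun h' => ?_⟩
    exact (h' ▸ mem_comp_self (fun h => hne h.symm) : y ∈ comp l ρ) h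
  rw [hl.2] at hcard
  exact hcard.false

/-- If the leaves are dense, then side branches start from every segment. -/
lemma IsRealTree.exists_branch {ρ x y : T} (hd : Dense (leaves ρ)) (hxy : Btw ρ x y)
    (hne : x ≠ y) : ∃ b w, Btw ρ x b ∧ x ≠ b ∧ Btw ρ b y ∧ b ≠ y ∧ Btw ρ b w ∧ b ≠ w ∧
      Btw w b y ∧ b ∈ branchPoints ρ := by
  obtain ⟨z, hz, hzx, hzy⟩ := hT.exists_btw_strict hne
  have hxz : Btw ρ x z := by
    have := hxy; unfold Btw at *
    linarith [dist_triangle ρ x z, dist_triangle ρ z y]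
  have hzyρ : Btw ρ z y := by
    unfold Btw at *; linarith
  -- A leaf closer to `z` than both `x` and `y` must leave the segment strictly between `x` and `y`;
  -- being a leaf, it cannot lie on the lineage of `y`.
  obtain ⟨l, hl, hlz⟩ := hd.exists_dist_lt z (lt_min (dist_pos.2 hzx) (dist_pos.2 hzy))
  have hl1 := hlz.trans_le (min_le_left _ _)
  have hl2 := hlz.trans_le (min_le_right _ _)
  obtain ⟨hxl, hlx⟩ := hT.btw_of_dist_lt hxz (by rwa [dist_comm x z])
  have hyl : ¬ Btw ρ y l := fun h => by
    have h1 := (hzyρ.trans_right h).dist_le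
    exact absurd hl2 (not_lt.2 h1)
  have hly : ¬ Btw ρ l y := fun h => hyl (hT.eq_of_mem_leaves hl h ▸ btw_right _ _)
  set b := hT.meet ρ l y with hb
  have hbl : b ≠ l := fun h => hly (h ▸ hT.meet_right ρ l y)
  have hby : b ≠ y := fun h => hyl (h ▸ hT.meet_left ρ l y)
  have hbx : x ≠ b := by
    intro h
    have hm := hT.btw_meet ρ l y
    rw [← hb, ← h] at hm
    have e1 := dist_triangle z l x
    unfold Btw at *
    have e2 := dist_triangle l z y
    rw [dist_comm l z] at e2
    rw [dist_comm x z] at *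
    have e3 := dist_pos.2 hzx
    linarith [dist_comm l x, dist_comm z l, dist_triangle z l x]
  have hxb : Btw ρ x b := hT.le_meet hxl hxy
  refine ⟨b, l, hxb, hbx, hT.meet_right _ _ _, hby, hT.meet_left _ _ _, hbl,
    hT.btw_meet _ _ _, ?_⟩
  refine hT.mem_branchPoints ?_ (hT.meet_left _ _ _) (hT.meet_right _ _ _) hbl.symm hby.symm
    (hT.btw_meet _ _ _)
  rintro h
  rw [h] at hxb hbx
  exact hbx (btw_self hxb)

/-- The index of the component of `x` in the complement of `b`. -/
def IsRealTree.index {ρ b x : T} (hb : b ∈ branchPoints ρ ∪ {ρ}) (h : Btw ρ b x) (hne : x ≠ b) :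
    ShuffleIndex ρ := ⟨(b, comp b x), hb, hT.mem_childComponents.2 ⟨x, hne, h, rfl⟩⟩

lemma IsRealTree.eq_index {ρ b x : T} (i : ShuffleIndex ρ) (hb : i.1.1 = b) (hx : x ∈ i.1.2) :
    ∃ (h₁ : b ∈ branchPoints ρ ∪ {ρ}) (h₂ : Btw ρ b x) (h₃ : x ≠ b), i = hT.index h₁ h₂ h₃ := by
  subst hb
  obtain ⟨⟨b, C⟩, h1, h2⟩ := i
  obtain ⟨y, hy, hby, hC⟩ := hT.mem_childComponents.1 h2
  dsimp only at hC
  subst hC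
  refine ⟨h1, hT.btw_of_mem_comp hby hx, ne_of_mem_comp hx, ?_⟩
  apply Subtype.ext
  simp only [IsRealTree.index]
  exact Prod.ext rfl (hT.comp_eq hy hx)

lemma IsRealTree.index_eq_iff {ρ b x y : T} {h₁ : b ∈ branchPoints ρ ∪ {ρ}} {h₂ : Btw ρ b x}
    {h₃ : x ≠ b} {h₄ : Btw ρ b y} {h₅ : y ≠ b} :
    hT.index h₁ h₂ h₃ = hT.index h₁ h₄ h₅ ↔ y ∈ comp b x := by
  constructor
  · intro h
    have : comp b x = comp b y := congrArg (fun i : ShuffleIndex ρ => i.1.2) h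
    rw [this]; exact mem_comp_self h₅
  · intro h
    exact Subtype.ext (Prod.ext rfl (hT.comp_eq h₃ h))

lemma IsRealTree.meet_mem {ρ x y : T} (hx : hT.meet ρ x y ≠ x) (hy : hT.meet ρ x y ≠ y) :
    hT.meet ρ x y ∈ branchPoints ρ ∪ {ρ} := by
  by_cases h : hT.meet ρ x y = ρ
  · exact Or.inr h
  · exact Or.inl (hT.mem_branchPoints h (hT.meet_left _ _ _) (hT.meet_right _ _ _) hx.symm hy.symm
      (hT.btw_meet _ _ _))

/-- Of at least three components at most one contains the root, which leaves two different ones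
above `b`. -/
lemma IsRealTree.exists_mem_branchPoints {ρ b : T} (hb : b ∈ branchPoints ρ) :
    ∃ x y, x ≠ b ∧ y ≠ b ∧ Btw ρ b x ∧ Btw ρ b y ∧ Btw x b y := by
  have h : 1 < (components b \ {comp b ρ}).encard := by
    have h1 : (components b) ⊆ (components b \ {comp b ρ}) ∪ {comp b ρ} := by
      intro C hC; by_cases h : C = comp b ρ <;> simp [h, hC]
    have h2 := (encard_le_encard h1).trans (encard_union_le _ _)
    rw [encard_singleton] at h2
    have h3 := hb.2.trans h2
    by_contra! h4
    have := h3.trans (add_le_add_left h4 1)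
    norm_num at this
  obtain ⟨C, C', ⟨hC, hCρ⟩, ⟨hC', hCρ'⟩, hne⟩ := one_lt_encard_iff.1 h
  obtain ⟨x, hx, rfl⟩ := hT.mem_components.1 hC
  obtain ⟨y, hy, rfl⟩ := hT.mem_components.1 hC'
  refine ⟨x, y, hx, hy, ?_, ?_, ?_⟩
  · by_contra h; exact hCρ (hT.comp_eq hb.1.symm h).symm
  · by_contra h; exact hCρ' (hT.comp_eq hb.1.symm h).symm
  · by_contra h; exact hne (hT.comp_eq hx h)

lemma IsRealTree.meet_of_btw {ρ b x y : T} (hx : Btw ρ b x) (hy : Btw ρ b y) (hxy : Btw x b y) :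
    hT.meet ρ x y = b := by
  by_contra h
  exact (hT.mem_comp_iff hx).2 ⟨hT.le_meet hx hy, h⟩ hxy

/-- Components are open, so each branching point is the meet of two points of a countable dense set.
-/
lemma IsRealTree.countable_branchPoints [SecondCountableTopology T] (ρ : T) :
    (branchPoints ρ).Countable := by
  obtain ⟨D, hDc, hD⟩ := TopologicalSpace.exists_countable_dense T
  refine ((hDc.prod hDc).image fun p => hT.meet ρ p.1 p.2).mono fun b hb => ?_
  obtain ⟨x, y, hx, hy, hbx, hby, hxy⟩ := hT.exists_mem_branchPoints hb
  obtain ⟨d, hdD, hd⟩ := hD.exists_mem_open (isOpen_comp b x) ⟨x, mem_comp_self hx⟩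
  obtain ⟨e, heD, he⟩ := hD.exists_mem_open (isOpen_comp b y) ⟨y, mem_comp_self hy⟩
  refine ⟨(d, e), ⟨hdD, heD⟩, hT.meet_of_btw (hT.btw_of_mem_comp hbx hd)
    (hT.btw_of_mem_comp hby he) ?_⟩
  by_contra h
  have : comp b x = comp b y := by
    rw [hT.comp_eq hx hd, hT.comp_eq hy he, hT.comp_eq (ne_of_mem_comp hd) h]
  exact (this ▸ mem_comp_self hy : y ∈ comp b x) hxy

lemma IsRealTree.countable_shuffleIndex [SecondCountableTopology T] (ρ : T) :
    Countable (ShuffleIndex ρ) := by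
  obtain ⟨D, hDc, hD⟩ := TopologicalSpace.exists_countable_dense T
  have hB : (branchPoints ρ ∪ {ρ}).Countable :=
    (hT.countable_branchPoints ρ).union (countable_singleton ρ)
  have : {p : T × Set T | p.1 ∈ branchPoints ρ ∪ {ρ} ∧ p.2 ∈ childComponents ρ p.1}.Countable := by
    refine ((hB.prod hDc).image fun p => (p.1, comp p.1 p.2)).mono ?_
    rintro ⟨b, C⟩ ⟨hb, hC⟩
    obtain ⟨x, hx, hbx, hC'⟩ := hT.mem_childComponents.1 hC
    dsimp only at hC'
    subst hC'
    obtain ⟨d, hdD, hd⟩ := hD.exists_mem_open (isOpen_comp b x) ⟨x, mem_comp_self hx⟩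
    exact ⟨(b, d), ⟨hb, hdD⟩, Prod.ext rfl (hT.comp_eq hx hd).symm⟩
  exact this.to_subtype

end Components

/-! ### Independent uniform labels -/

section Labels

variable {ι Ω : Type*} [MeasurableSpace Ω] {P : Measure Ω} [IsProbabilityMeasure P]
  {U : ι → Ω → ℝ}

lemma IsIIDUniform.ae_ne (hU : IsIIDUniform P U) {i j : ι} (hij : i ≠ j) :
    ∀ᵐ ω ∂P, U i ω ≠ U j ω := by
  have h := (indepFun_iff_map_prod_eq_prod_map_map (hU.measurable i).aemeasurable
    (hU.measurable j).aemeasurable).1 (hU.indep.indepFun hij)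
  rw [hU.law i, hU.law j] at h
  have hm : MeasurableSet {p : ℝ × ℝ | p.1 = p.2} := measurableSet_eq_fun measurable_fst
    measurable_snd
  have h0 : ((volume.restrict (Icc (0 : ℝ) 1)).prod (volume.restrict (Icc (0 : ℝ) 1)))
      {p : ℝ × ℝ | p.1 = p.2} = 0 := by
    rw [Measure.measure_prod_null hm]
    refine Eventually.of_forall fun x => ?_
    have : (Prod.mk x ⁻¹' {p : ℝ × ℝ | p.1 = p.2}) = {x} := by ext; simp [eq_comm]
    dsimp only
    rw [this]
    simp
  rw [← h, Measure.map_apply ((hU.measurable i).prodMk (hU.measurable j)) hm] at h0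
  rw [ae_iff]
  simpa using h0

lemma IsIIDUniform.ae_injective [Countable ι] (hU : IsIIDUniform P U) :
    ∀ᵐ ω ∂P, Function.Injective fun i => U i ω := by
  have : ∀ᵐ ω ∂P, ∀ i j, i ≠ j → U i ω ≠ U j ω := by
    rw [ae_all_iff]; intro i
    rw [ae_all_iff]; intro j
    by_cases hij : i = j
    · simp [hij]
    · filter_upwards [hU.ae_ne hij] with ω h _ using h
  filter_upwards [this] with ω h i j hij
  by_contra hne
  exact h i j hne hij

/-- The events that one label is below 1/2 and its partner above 1/2 are independent, because all
indices differ, and each has probability 1/4. By the second Borel-Cantelli lemma infinitely many of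
them occur. -/
lemma IsIIDUniform.ae_exists_lt (hU : IsIIDUniform P U) {i j : ℕ → ι}
    (hij : Function.Injective (Sum.elim i j)) : ∀ᵐ ω ∂P, ∃ n, U (i n) ω < U (j n) ω := by
  let I : Bool → Set ℝ := fun b => if b then Ioi (1 / 2) else Iio (1 / 2)
  have hI : ∀ b, MeasurableSet (I b) := by
    intro b; cases b
    · exact measurableSet_Iio
    · exact measurableSet_Ioi
  let g : ℕ × Bool → ι := fun p => if p.2 then j p.1 else i p.1
  have hg : Function.Injective g := by
    rintro ⟨n, b⟩ ⟨m, c⟩ h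
    cases b <;> cases c <;> simp only [g, if_true, Bool.false_eq_true, if_false] at h
    · have := @hij (Sum.inl n) (Sum.inl m) h
      simpa using this
    · have := @hij (Sum.inl n) (Sum.inr m) h
      simp at this
    · have := @hij (Sum.inr n) (Sum.inl m) h
      simp at this
    · have := @hij (Sum.inr n) (Sum.inr m) h
      simpa using this
  have hV := hU.indep.precomp hg
  let A : ℕ → Set Ω := fun n => ⋂ b : Bool, U (g (n, b)) ⁻¹' I b
  have hA : ∀ n, MeasurableSet (A n) := fun n =>
    MeasurableSet.iInter fun b => hU.measurable _ (hI b)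
  have hmul : ∀ S : Finset ℕ, P (⋂ n ∈ S, A n) = ∏ _n ∈ S, ∏ _b : Bool, (1 / 2 : ENNReal) := by
    intro S
    have h := hV.meas_biInter (S := S ×ˢ Finset.univ) (s := fun p => U (g p) ⁻¹' I p.2)
      (fun p _ => ⟨_, hI p.2, rfl⟩)
    have hset : (⋂ n ∈ S, A n) = ⋂ p ∈ S ×ˢ (Finset.univ : Finset Bool), U (g p) ⁻¹' I p.2 := by
      ext ω
      simp only [A, mem_iInter, mem_preimage, Finset.mem_product, Finset.mem_univ, and_true,
        Prod.forall]
      exact ⟨fun h a b ha => h a ha b, fun h a ha b => h a b ha⟩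
    rw [hset, h, Finset.prod_product]
    refine Finset.prod_congr rfl fun n _ => Finset.prod_congr rfl fun b _ => ?_
    rw [← Measure.map_apply (hU.measurable _) (hI b), hU.law, Measure.restrict_apply (hI b)]
    cases b
    · have : I false ∩ Icc 0 1 = Ico 0 (1 / 2) := by
        ext x; simp only [I, Bool.false_eq_true, if_false, mem_inter_iff, mem_Iio, mem_Icc, mem_Ico]
        constructor
        · rintro ⟨h1, h2, h3⟩; exact ⟨h2, h1⟩
        · rintro ⟨h1, h2⟩; exact ⟨h2, h1, by linarith⟩
      rw [this, Real.volume_Ico, sub_zero, ENNReal.ofReal_div_of_pos (by norm_num)]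
      simp
    · have : I true ∩ Icc 0 1 = Ioc (1 / 2) 1 := by
        ext x; simp only [I, if_true, mem_inter_iff, mem_Ioi, mem_Icc, mem_Ioc]
        constructor
        · rintro ⟨h1, h2, h3⟩; exact ⟨h1, h3⟩
        · rintro ⟨h1, h2⟩; exact ⟨h1, by linarith, h2⟩
      rw [this, Real.volume_Ioc, show (1 : ℝ) - 1 / 2 = 1 / 2 by norm_num,
        ENNReal.ofReal_div_of_pos (by norm_num)]
      simp
  have hPA : ∀ n, P (A n) = ∏ _b : Bool, (1 / 2 : ENNReal) := fun n => by
    simpa using hmul {n}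
  have hind : iIndepSet A P := by
    rw [iIndepSet_iff_meas_biInter hA]
    intro S
    rw [hmul]
    exact Finset.prod_congr rfl fun n _ => (hPA n).symm
  have hsum : ∑' n, P (A n) = ⊤ := by
    simp_rw [hPA]
    refine ENNReal.tsum_const_eq_top_of_ne_zero ?_
    simp
  have hlim := measure_limsup_eq_one hA hind hsum
  have hlim' : ∀ᵐ ω ∂P, ω ∈ limsup A atTop :=
    (prob_compl_eq_zero_iff (MeasurableSet.measurableSet_limsup hA)).2 hlim
  filter_upwards [hlim'] with ω hω
  rw [limsup_eq_iInf_iSup_of_nat] at hω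
  simp only [iInf_eq_iInter, iSup_eq_iUnion, mem_iInter, mem_iUnion] at hω
  obtain ⟨n, -, hn⟩ := hω 0
  rw [mem_iInter] at hn
  have h1 := hn false
  have h2 := hn true
  simp only [g, I, mem_preimage, Bool.false_eq_true, if_false, if_true, mem_Iio, mem_Ioi] at h1 h2
  exact ⟨n, h1.trans h2⟩

end Labels

/-! ### The shuffled order is almost surely a plane order -/

section Order

variable {T : Type*} [MetricSpace T]

/-- A linear order on a rooted real tree that extends the genealogical order, for which the
subtrees above a point are order-convex, and such that side branches start on both sides of every
segment. -/
structure IsPlaneOrder (ρ : T) (r : T → T → Prop) : Prop where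
  total : ∀ x y, r x y ∨ r y x
  antisymm : ∀ x y, r x y → r y x → x = y
  trans : ∀ x y z, r x y → r y z → r x z
  of_btw : ∀ x y, Btw ρ x y → r x y
  convex : ∀ c x y, ¬ Btw ρ c x → Btw ρ c y → r x y → r x c
  left : ∀ x y, Btw ρ x y → x ≠ y → ∃ O : Set T, IsOpen O ∧ O.Nonempty ∧
    ∀ o ∈ O, Btw ρ x o ∧ x ≠ o ∧ ¬ Btw ρ y o ∧ r o y
  right : ∀ x y, Btw ρ x y → x ≠ y → ∃ O : Set T, IsOpen O ∧ O.Nonempty ∧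
    ∀ o ∈ O, Btw ρ x o ∧ x ≠ o ∧ ¬ Btw ρ y o ∧ r y o

variable (hT : IsRealTree T)
include hT

lemma IsRealTree.shuffleLE_iff {ρ : T} {u : ShuffleIndex ρ → ℝ} {x y : T} :
    shuffleLE ρ u x y ↔ Btw ρ x y ∨ ∃ (hx : hT.meet ρ x y ≠ x) (hy : hT.meet ρ x y ≠ y),
      u (hT.index (hT.meet_mem hx hy) (hT.meet_left ρ x y) hx.symm) ≤
        u (hT.index (hT.meet_mem hx hy) (hT.meet_right ρ x y) hy.symm) := by
  unfold shuffleLE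
  rw [hT.mem_segment]
  refine or_congr_right ⟨?_, ?_⟩
  · rintro ⟨b, hb, hx, hy, i, j, hi, hj, hxi, hyj, hij⟩
    obtain rfl := hT.isMeet_iff.1 hb
    obtain ⟨_, _, _, rfl⟩ := hT.eq_index i hi hxi
    obtain ⟨_, _, _, rfl⟩ := hT.eq_index j hj hyj
    exact ⟨hx, hy, hij⟩
  · rintro ⟨hx, hy, h⟩
    exact ⟨_, hT.isMeet_iff.2 rfl, hx, hy, _, _, rfl, rfl, mem_comp_self hx.symm,
      mem_comp_self hy.symm, h⟩

lemma IsRealTree.shuffleLE_iff_of_btw {ρ : T} {u : ShuffleIndex ρ → ℝ} {b x y : T}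
    (hb : b ∈ branchPoints ρ ∪ {ρ}) (hbx : Btw ρ b x) (hby : Btw ρ b y) (hx : x ≠ b) (hy : y ≠ b)
    (hxy : Btw x b y) :
    shuffleLE ρ u x y ↔ u (hT.index hb hbx hx) ≤ u (hT.index hb hby hy) := by
  have hm : hT.meet ρ x y = b := hT.meet_of_btw hbx hby hxy
  rw [hT.shuffleLE_iff]
  subst hm
  constructor
  · rintro (h | ⟨_, _, h⟩)
    · exact absurd (hT.meet_eq_left h).symm hx
    · exact h
  · intro h
    exact Or.inr ⟨hx.symm, hy.symm, h⟩

lemma shuffleLE_of_btw {ρ : T} {u : ShuffleIndex ρ → ℝ} {x y : T}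
    (h : Btw ρ x y) : shuffleLE ρ u x y := Or.inl (hT.mem_segment.2 h)

lemma IsRealTree.meet_ne {ρ x y : T} (hxy : ¬ Btw ρ x y) (hyx : ¬ Btw ρ y x) :
    hT.meet ρ x y ≠ x ∧ hT.meet ρ x y ≠ y :=
  ⟨fun h => hxy (h ▸ hT.meet_right ρ x y), fun h => hyx (h ▸ hT.meet_left ρ x y)⟩

lemma IsRealTree.shuffleLE_total {ρ : T} {u : ShuffleIndex ρ → ℝ} (x y : T) :
    shuffleLE ρ u x y ∨ shuffleLE ρ u y x := by
  by_cases hxy : Btw ρ x y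
  · exact Or.inl (shuffleLE_of_btw hT hxy)
  by_cases hyx : Btw ρ y x
  · exact Or.inr (shuffleLE_of_btw hT hyx)
  obtain ⟨hx, hy⟩ := hT.meet_ne hxy hyx
  have hm := hT.meet_mem hx hy
  rw [hT.shuffleLE_iff_of_btw hm (hT.meet_left _ _ _) (hT.meet_right _ _ _) hx.symm hy.symm
    (hT.btw_meet _ _ _), hT.shuffleLE_iff_of_btw hm (hT.meet_right _ _ _) (hT.meet_left _ _ _)
    hy.symm hx.symm (hT.btw_meet _ _ _).symm]
  exact le_total _ _

lemma IsRealTree.shuffleLE_antisymm {ρ : T} {u : ShuffleIndex ρ → ℝ}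
    (hu : Function.Injective u) {x y : T} (h1 : shuffleLE ρ u x y) (h2 : shuffleLE ρ u y x) :
    x = y := by
  have key : ∀ x y, Btw ρ x y → shuffleLE ρ u y x → x = y := by
    intro x y hxy h
    rcases hT.shuffleLE_iff.1 h with h | ⟨_, h, _⟩
    · exact hxy.antisymm h
    · exact absurd ((hT.meet_comm _ _ _).trans (hT.meet_eq_left hxy)) h
  by_cases hxy : Btw ρ x y
  · exact key x y hxy h2
  by_cases hyx : Btw ρ y x
  · exact (key y x hyx h1).symm
  exfalso
  obtain ⟨hx, hy⟩ := hT.meet_ne hxy hyx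
  have hm := hT.meet_mem hx hy
  rw [hT.shuffleLE_iff_of_btw hm (hT.meet_left _ _ _) (hT.meet_right _ _ _) hx.symm hy.symm
    (hT.btw_meet _ _ _)] at h1
  rw [hT.shuffleLE_iff_of_btw hm (hT.meet_right _ _ _) (hT.meet_left _ _ _)
    hy.symm hx.symm (hT.btw_meet _ _ _).symm] at h2
  exact hT.index_eq_iff.1 (hu (h1.antisymm h2)) (hT.btw_meet _ _ _)

/-- Seen from a point `x` outside the subtree above `c`, the points `c` and `y` lie in the same
component at the separation point, so the same two labels are compared. -/
lemma IsRealTree.shuffleLE_congr {ρ : T} {u : ShuffleIndex ρ → ℝ} {c x y : T}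
    (hcx : ¬ Btw ρ c x) (hcy : Btw ρ c y) : shuffleLE ρ u x y ↔ shuffleLE ρ u x c := by
  by_cases hxy : Btw ρ x y
  · have hxc := (hT.btw_total hxy hcy).resolve_right hcx
    exact ⟨fun _ => shuffleLE_of_btw hT hxc, fun _ => shuffleLE_of_btw hT hxy⟩
  · have hyx : ¬ Btw ρ y x := fun h => hcx (hcy.trans h)
    obtain ⟨hx, hy⟩ := hT.meet_ne hxy hyx
    have hm := hT.meet_mem hx hy
    have h1 := hT.meet_left ρ x y
    have h2 := hT.meet_right ρ x y
    have h3 := hT.btw_meet ρ x y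
    set b := hT.meet ρ x y
    have hbc : Btw ρ b c := (hT.btw_total h2 hcy).resolve_right fun h => hcx (h.trans h1)
    have hne : c ≠ b := by rintro rfl; exact hcx h1
    have hcby : Btw y c b := (hbc.trans_right hcy).symm
    have h4 : Btw x b c := (hcby.trans_right h3.symm).symm
    rw [hT.shuffleLE_iff_of_btw hm h1 h2 hx.symm hy.symm h3,
      hT.shuffleLE_iff_of_btw hm h1 hbc hx.symm hne h4]
    rw [hT.index_eq_iff.2 (hT.mem_comp_of_btw hbc hne hcy (btw_right _ _))]

lemma IsRealTree.shuffleLE_congr' {ρ : T} {u : ShuffleIndex ρ → ℝ} (hu : Function.Injective u)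
    {c x y : T} (hcx : ¬ Btw ρ c x) (hcy : Btw ρ c y) :
    shuffleLE ρ u y x ↔ shuffleLE ρ u c x := by
  have h := hT.shuffleLE_congr (u := u) hcx hcy
  constructor
  · intro h1
    rcases hT.shuffleLE_total (u := u) c x with h2 | h2
    · exact h2
    · exact absurd (hT.shuffleLE_antisymm hu h1 (h.2 h2) ▸ hcy) hcx
  · intro h1
    rcases hT.shuffleLE_total (u := u) y x with h2 | h2
    · exact h2
    · exact absurd (hT.shuffleLE_antisymm hu h1 (h.1 h2) ▸ btw_right _ _) hcx

lemma IsRealTree.shuffleLE_trans {ρ : T} {u : ShuffleIndex ρ → ℝ} (hu : Function.Injective u)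
    {x y z : T} (hxy : shuffleLE ρ u x y) (hyz : shuffleLE ρ u y z) : shuffleLE ρ u x z := by
  have a1 := hT.meet_left ρ x y
  have a2 := hT.meet_right ρ x y
  have a3 := hT.btw_meet ρ x y
  have a4 := fun w => hT.le_meet (a := ρ) (x := x) (y := y) (z := w)
  have hm := hT.meet_mem (ρ := ρ) (x := x) (y := y)
  have c1 := hT.meet_left ρ y z
  have c2 := hT.meet_right ρ y z
  have c3 := hT.btw_meet ρ y z
  have c4 := fun w => hT.le_meet (a := ρ) (x := y) (y := z) (z := w)
  set b := hT.meet ρ x y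
  set d := hT.meet ρ y z
  -- Both meets are ancestors of `y`. If they coincide, the labels at one point are compared;
  -- otherwise `z` or `x` lies in the same subtree as `y` relative to the third point, and
  -- `shuffleLE_congr` or `shuffleLE_congr'` exchanges them.
  by_cases hbd : b = d
  · rw [← hbd] at c1 c2 c3 c4
    by_cases hx : b = x
    · rw [hx] at c2; exact shuffleLE_of_btw hT c2
    by_cases hy : b = y
    · rw [hy] at a1
      rwa [hT.shuffleLE_antisymm hu hxy (shuffleLE_of_btw hT a1)]
    by_cases hz : b = z
    · rw [hz] at c1
      rwa [← hT.shuffleLE_antisymm hu hyz (shuffleLE_of_btw hT c1)]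
    have hmm := hm hx hy
    rw [hT.shuffleLE_iff_of_btw hmm a1 a2 (Ne.symm hx) (Ne.symm hy) a3] at hxy
    rw [hT.shuffleLE_iff_of_btw hmm c1 c2 (Ne.symm hy) (Ne.symm hz) c3] at hyz
    by_cases hxz : Btw x b z
    · rw [hT.shuffleLE_iff_of_btw hmm a1 c2 (Ne.symm hx) (Ne.symm hz) hxz]
      exact hxy.trans hyz
    · have hi : hT.index hmm a1 (Ne.symm hx) = hT.index hmm c2 (Ne.symm hz) :=
        hT.index_eq_iff.2 hxz
      rw [← hi] at hyz
      exact absurd a3 (hT.index_eq_iff.1 (hu (hxy.antisymm hyz)))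
  · rcases hT.btw_total a2 c1 with h | h
    · have hdx : ¬ Btw ρ d x := fun h' => hbd (h.antisymm (a4 d h' c1))
      rw [hT.shuffleLE_congr hdx c2, ← hT.shuffleLE_congr hdx c1]
      exact hxy
    · have hbz : ¬ Btw ρ b z := fun h' => hbd ((c4 b a2 h').antisymm h)
      rw [hT.shuffleLE_congr' hu hbz a1, ← hT.shuffleLE_congr' hu hbz a2]
      exact hyz

/-- Strictly between any two comparable branching points, a side branch starts whose label `a`
and the label `b` of the branch that goes on satisfy `p a b`. -/
def HasSideBranches (ρ : T) (u : ShuffleIndex ρ → ℝ) (p : ℝ → ℝ → Prop) : Prop :=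
  ∀ x ∈ branchPoints ρ, ∀ y ∈ branchPoints ρ, Btw ρ x y → x ≠ y →
    ∃ i j : ShuffleIndex ρ, i.1.1 = j.1.1 ∧ Btw ρ x i.1.1 ∧ y ∈ j.1.2 ∧ p (u i) (u j)

lemma IsRealTree.exists_open_of_hasSideBranches {ρ : T} {u : ShuffleIndex ρ → ℝ}
    {p : ℝ → ℝ → Prop} (hd : Dense (leaves ρ)) (hp : ∀ a, ¬ p a a) (h : HasSideBranches ρ u p)
    {x y : T} (hxy : Btw ρ x y) (hne : x ≠ y) : ∃ O : Set T, IsOpen O ∧ O.Nonempty ∧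
      ∀ o ∈ O, Btw ρ x o ∧ x ≠ o ∧ ¬ Btw ρ y o ∧ ∃ i j : ShuffleIndex ρ,
        p (u i) (u j) ∧ (shuffleLE ρ u o y ↔ u i ≤ u j) ∧ (shuffleLE ρ u y o ↔ u j ≤ u i) := by
  -- The hypothesis `h` speaks only of branching points, which are countably many; any segment
  -- contains two of them in its interior, and a side branch between these serves `x` and `y`.
  obtain ⟨b₂, -, h1, h2, h3, h4, -, -, -, hb₂⟩ := hT.exists_branch hd hxy hne
  obtain ⟨b₁, -, g1, g2, g3, g4, -, -, -, hb₁⟩ := hT.exists_branch hd h1 h2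
  obtain ⟨i, j, hij, hi, hj, hpij⟩ := h b₁ hb₁ b₂ hb₂ g3 g4
  obtain ⟨b, hjb⟩ : ∃ b, j.1.1 = b := ⟨_, rfl⟩
  rw [hjb] at hij
  obtain ⟨hb, e1, e2, rfl⟩ := hT.eq_index j hjb hj
  obtain ⟨w, hw1, hw2, hw3⟩ := hT.mem_childComponents.1 i.2.2
  rw [hij] at hi hw1 hw2 hw3
  obtain ⟨_, _, _, rfl⟩ := hT.eq_index i hij (hw3 ▸ mem_comp_self hw1)
  have hby : Btw ρ b y := e1.trans h3
  have hyb : y ≠ b := by rintro h'; rw [h'] at h3; exact e2 (h3.antisymm e1)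
  have hyj : hT.index hb e1 e2 = hT.index hb hby hyb :=
    hT.index_eq_iff.2 (hT.mem_comp_of_btw e1 e2 (btw_right _ _) h3)
  rw [hyj] at hpij
  refine ⟨comp b w, isOpen_comp _ _, ⟨w, mem_comp_self hw1⟩, fun o ho => ?_⟩
  have hbo : Btw ρ b o := hT.btw_of_mem_comp hw2 ho
  have hob := ne_of_mem_comp ho
  have hoi : hT.index hb hw2 hw1 = hT.index hb hbo hob := hT.index_eq_iff.2 ho
  rw [hoi] at hpij
  have hxb : Btw ρ x b := g1.trans hi
  -- Irreflexivity of `p` makes the two indices different, hence the side branch is not the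
  -- component of `y`.
  have hoby : Btw o b y := by
    by_contra hc
    have : hT.index hb hbo hob = hT.index hb hby hyb := hT.index_eq_iff.2 hc
    rw [this] at hpij
    exact hp _ hpij
  refine ⟨hxb.trans hbo, ?_, ?_, _, _, hpij,
    hT.shuffleLE_iff_of_btw hb hbo hby hob hyb hoby,
    hT.shuffleLE_iff_of_btw hb hby hbo hyb hob hoby.symm⟩
  · rintro rfl; exact hob (hbo.antisymm hxb).symm
  · intro hyo
    exact hT.mem_comp_of_btw hby hyb hyo (btw_right _ _) hoby

lemma IsRealTree.isPlaneOrder_shuffleLE {ρ : T} {u : ShuffleIndex ρ → ℝ} (hd : Dense (leaves ρ))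
    (hu : Function.Injective u) (hl : HasSideBranches ρ u (· < ·))
    (hr : HasSideBranches ρ u (· > ·)) : IsPlaneOrder ρ (shuffleLE ρ u) where
  total := hT.shuffleLE_total
  antisymm _ _ := hT.shuffleLE_antisymm hu
  trans _ _ _ := hT.shuffleLE_trans hu
  of_btw _ _ := shuffleLE_of_btw hT
  convex _ _ _ h1 h2 := (hT.shuffleLE_congr h1 h2).1
  left x y hxy hne := by
    obtain ⟨O, hO, hO', h⟩ := hT.exists_open_of_hasSideBranches hd (fun a => lt_irrefl a) hl hxy hne
    refine ⟨O, hO, hO', fun o ho => ?_⟩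
    obtain ⟨h1, h2, h3, i, j, h4, h5, -⟩ := h o ho
    exact ⟨h1, h2, h3, h5.2 h4.le⟩
  right x y hxy hne := by
    obtain ⟨O, hO, hO', h⟩ := hT.exists_open_of_hasSideBranches hd (p := (· > ·))
      (fun a => lt_irrefl a) hr hxy hne
    refine ⟨O, hO, hO', fun o ho => ?_⟩
    obtain ⟨h1, h2, h3, i, j, h4, -, h5⟩ := h o ho
    exact ⟨h1, h2, h3, h5.2 (le_of_lt h4)⟩

/-- Infinitely many side branches start between two points. -/
lemma IsRealTree.exists_seq_index {ρ x y : T} (hd : Dense (leaves ρ)) (hxy : Btw ρ x y)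
    (hne : x ≠ y) : ∃ i j : ℕ → ShuffleIndex ρ, Function.Injective (Sum.elim i j) ∧
      ∀ n, (i n).1.1 = (j n).1.1 ∧ Btw ρ x (i n).1.1 ∧ y ∈ (j n).1.2 := by
  let B : Set T := {b | ∃ w, Btw ρ x b ∧ x ≠ b ∧ Btw ρ b y ∧ b ≠ y ∧ Btw ρ b w ∧ b ≠ w ∧
      Btw w b y ∧ b ∈ branchPoints ρ}
  have hB : B.Infinite := by
    -- If there were finitely many, the one nearest to the root would be beaten by a branching point
    -- between `x` and it.
    intro hfin
    obtain ⟨b, hb, hmin⟩ := hfin.exists_minimalFor (fun b => dist ρ b) B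
      (by obtain ⟨b, hb⟩ := hT.exists_branch hd hxy hne; exact ⟨b, hb⟩)
    obtain ⟨w, h1, h2, h3, h4, -⟩ := hb
    obtain ⟨b', w', g1, g2, g3, g4, g5, g6, g7, g8⟩ := hT.exists_branch hd h1 h2
    have hb' : Btw ρ b' y := g3.trans h3
    have hb'y : b' ≠ y := by rintro rfl; exact h4 (h3.antisymm g3)
    have hw' : Btw w' b' y := by
      by_contra hc
      have e1 := hT.mem_comp_of_btw g3 g4.symm (btw_right _ _) h3
      have e2 := hT.comp_eq g6.symm hc
      have e3 := hT.comp_eq g4.symm e1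
      exact (show b ∈ comp b' w' by rw [e2, ← e3]; exact mem_comp_self g4.symm) g7
    have := hmin (j := b') ⟨w', g1, g2, hb', hb'y, g5, g6, hw', g8⟩ g3.dist_le
    exact absurd (g3.dist_lt g4) (not_lt.2 this)
  let f := hB.natEmbedding
  choose w h1 h2 h3 h4 h5 h6 h7 h8 using fun n => (f n).2
  refine ⟨fun n => hT.index (Or.inl (h8 n)) (h5 n) (h6 n).symm,
    fun n => hT.index (Or.inl (h8 n)) (h3 n) (h4 n).symm, ?_, fun n => ⟨rfl, h1 n, ?_⟩⟩
  · have hbase : ∀ n m, (f n : T) = f m → n = m := fun n m h => f.injective (Subtype.ext h)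
    rintro (n | n) (m | m) h <;> simp only [Sum.elim_inl, Sum.elim_inr] at h
    · rw [hbase n m (congrArg (fun i : ShuffleIndex ρ => i.1.1) h)]
    · obtain rfl := hbase n m (congrArg (fun i : ShuffleIndex ρ => i.1.1) h)
      exact absurd (h7 n) (hT.index_eq_iff.1 h)
    · obtain rfl := hbase n m (congrArg (fun i : ShuffleIndex ρ => i.1.1) h)
      exact absurd (h7 n) (hT.index_eq_iff.1 h.symm)
    · rw [hbase n m (congrArg (fun i : ShuffleIndex ρ => i.1.1) h)]
  · exact mem_comp_self (h4 n).symm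

/-- The only probabilistic step of the argument: three almost sure properties of the labels, each a
countable conjunction. -/
lemma IsRealTree.ae_isPlaneOrder [SecondCountableTopology T] {ρ : T} (hd : Dense (leaves ρ))
    {Ω : Type*} [MeasurableSpace Ω] {P : Measure Ω} [IsProbabilityMeasure P]
    {U : ShuffleIndex ρ → Ω → ℝ} (hU : IsIIDUniform P U) :
    ∀ᵐ ω ∂P, IsPlaneOrder ρ (shuffleLE ρ fun i => U i ω) := by
  have := hT.countable_shuffleIndex ρ
  have hc := hT.countable_branchPoints ρ
  have hl : ∀ᵐ ω ∂P, HasSideBranches ρ (fun i => U i ω) (· < ·) := by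
    unfold HasSideBranches
    rw [ae_ball_iff hc]; intro x hx
    rw [ae_ball_iff hc]; intro y hy
    by_cases hxy : Btw ρ x y ∧ x ≠ y
    · obtain ⟨i, j, hij, h⟩ := hT.exists_seq_index hd hxy.1 hxy.2
      filter_upwards [hU.ae_exists_lt hij] with ω ⟨n, hn⟩ _ _
      exact ⟨i n, j n, (h n).1, (h n).2.1, (h n).2.2, hn⟩
    · exact Eventually.of_forall fun ω h1 h2 => absurd ⟨h1, h2⟩ hxy
  have hr : ∀ᵐ ω ∂P, HasSideBranches ρ (fun i => U i ω) (· > ·) := by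
    unfold HasSideBranches
    rw [ae_ball_iff hc]; intro x hx
    rw [ae_ball_iff hc]; intro y hy
    by_cases hxy : Btw ρ x y ∧ x ≠ y
    · obtain ⟨i, j, hij, h⟩ := hT.exists_seq_index hd hxy.1 hxy.2
      have hij' : Function.Injective (Sum.elim j i) := by
        rw [← Sum.elim_comp_inl_inr (Sum.elim j i)]
        have : Sum.elim j i = Sum.elim i j ∘ Sum.swap := by
          ext (n | n) <;> rfl
        rw [Sum.elim_comp_inl_inr, this]
        exact hij.comp Sum.swap_leftInverse.injective
      filter_upwards [hU.ae_exists_lt hij'] with ω ⟨n, hn⟩ _ _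
      exact ⟨i n, j n, (h n).1, (h n).2.1, (h n).2.2, hn⟩
    · exact Eventually.of_forall fun ω h1 h2 => absurd ⟨h1, h2⟩ hxy
  filter_upwards [hl, hr, hU.ae_injective] with ω h1 h2 h3
  exact hT.isPlaneOrder_shuffleLE hd h3 h1 h2

end Order

/-! ### Separating points by open sets in the order -/

section Separation

variable {T : Type*} [MetricSpace T] {ρ : T} {r : T → T → Prop}

/-- `o` lies strictly between `x` and `y` for the order `r`. -/
def SBtw (r : T → T → Prop) (x o y : T) : Prop := r x o ∧ x ≠ o ∧ r o y ∧ o ≠ y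

namespace IsPlaneOrder

lemma refl (hr : IsPlaneOrder ρ r) (x : T) : r x x := hr.of_btw x x (btw_right _ _)

lemma convex_right (hr : IsPlaneOrder ρ r) {c x y y' : T} (hx : ¬ Btw ρ c x) (hy : Btw ρ c y)
    (hy' : Btw ρ c y') (h : r x y) : r x y' :=
  hr.trans _ _ _ (hr.convex c x y hx hy h) (hr.of_btw _ _ hy')

lemma convex_left (hr : IsPlaneOrder ρ r) {c x y y' : T} (hx : ¬ Btw ρ c x) (hy : Btw ρ c y)
    (hy' : Btw ρ c y') (h : r y x) : r y' x := by
  rcases hr.total y' x with h' | h'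
  · exact h'
  · have := hr.antisymm _ _ h (hr.convex_right hx hy' hy h')
    exact absurd (this ▸ hy) hx

variable (hT : IsRealTree T)
include hT

/-- Two distinct points have neighbourhoods that are separated by non-empty open sets. -/
lemma exists_separation_aux (hr : IsPlaneOrder ρ r) {x y : T} (hyx : ¬ Btw ρ y x) :
    ∃ V ∈ 𝓝 x, ∃ W ∈ 𝓝 y, ∃ O₁ O₂ : Set T, IsOpen O₁ ∧ O₁.Nonempty ∧ IsOpen O₂ ∧ O₂.Nonempty ∧
      ∀ a ∈ V, ∀ b ∈ W, (∀ o ∈ O₁, SBtw r a o b) ∨ (∀ o ∈ O₂, SBtw r b o a) := by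
  have hne : hT.meet ρ x y ≠ y := fun h => hyx (h ▸ hT.meet_left ρ x y)
  -- Two marks `c₁`, `c₂` are placed on the lineage of `y` after it leaves that of `x`. Points `a`
  -- near `x` stay outside the subtree of `c₁`, points `b` near `y` lie beyond `c₂`, and side
  -- branches between the marks fall between `a` and `b` by convexity, whichever of the two comes
  -- first.
  obtain ⟨c₂, h1, h2, h3⟩ := hT.exists_btw_strict hne
  have hmy := hT.meet_right ρ x y
  have hmc : Btw ρ (hT.meet ρ x y) c₂ := by
    unfold Btw at *
    linarith [dist_triangle ρ (hT.meet ρ x y) c₂, dist_triangle ρ c₂ y]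
  have hcy : Btw ρ c₂ y := by unfold Btw at *; linarith
  obtain ⟨c₁, g1, g2, g3⟩ := hT.exists_btw_strict h2.symm
  have hmc' : Btw ρ (hT.meet ρ x y) c₁ := by
    unfold Btw at *
    linarith [dist_triangle ρ (hT.meet ρ x y) c₁, dist_triangle ρ c₁ c₂]
  have hcc : Btw ρ c₁ c₂ := by unfold Btw at *; linarith
  have hcx : ¬ Btw ρ c₁ x := fun h =>
    g2 ((hT.le_meet h (hcc.trans hcy)).antisymm hmc')
  obtain ⟨O₁, hO₁, hO₁', hl⟩ := hr.left c₁ c₂ hcc g3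
  obtain ⟨O₂, hO₂, hO₂', hrt⟩ := hr.right c₁ c₂ hcc g3
  refine ⟨{a | Btw ρ c₁ a}ᶜ, (isClosed_btw ρ c₁).isOpen_compl.mem_nhds hcx,
    {b | Btw ρ c₂ b ∧ b ≠ c₂}, (hT.isOpen_btw ρ c₂).mem_nhds ⟨hcy, h3.symm⟩, O₁, O₂, hO₁, hO₁',
    hO₂, hO₂', ?_⟩
  rintro a ha b ⟨hb, -⟩
  have ha' : ¬ Btw ρ c₁ a := ha
  have hb' := hcc.trans hb
  rcases hr.total a b with hab | hba
  · refine Or.inl fun o ho => ?_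
    obtain ⟨e1, e2, e3, e4⟩ := hl o ho
    refine ⟨hr.convex_right ha' hb' e1 hab, ?_, hr.trans _ _ _ e4 (hr.of_btw _ _ hb), ?_⟩
    · rintro rfl; exact ha' e1
    · rintro rfl; exact e3 hb
  · refine Or.inr fun o ho => ?_
    obtain ⟨e1, e2, e3, e4⟩ := hrt o ho
    refine ⟨hr.convex_left e3 (btw_right _ _) hb e4, ?_, hr.convex_left ha' hb' e1 hba, ?_⟩
    · rintro rfl; exact e3 hb
    · rintro rfl; exact ha' e1

lemma exists_separation (hr : IsPlaneOrder ρ r) {x y : T} (hxy : x ≠ y) :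
    ∃ V ∈ 𝓝 x, ∃ W ∈ 𝓝 y, ∃ O₁ O₂ : Set T, IsOpen O₁ ∧ O₁.Nonempty ∧ IsOpen O₂ ∧ O₂.Nonempty ∧
      ∀ a ∈ V, ∀ b ∈ W, (∀ o ∈ O₁, SBtw r a o b) ∨ (∀ o ∈ O₂, SBtw r b o a) := by
  by_cases hyx : Btw ρ y x
  · have : ¬ Btw ρ x y := fun h => hxy (h.antisymm hyx)
    obtain ⟨V, hV, W, hW, O₁, O₂, h1, h1', h2, h2', h⟩ := hr.exists_separation_aux hT this
    exact ⟨W, hW, V, hV, O₂, O₁, h2, h2', h1, h1', fun a ha b hb => (h b hb a ha).symm⟩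
  · exact hr.exists_separation_aux hT hyx

lemma exists_open_sbtw (hr : IsPlaneOrder ρ r) {x y : T} (h : r x y) (hxy : x ≠ y) :
    ∃ O : Set T, IsOpen O ∧ O.Nonempty ∧ ∀ o ∈ O, SBtw r x o y := by
  obtain ⟨V, hV, W, hW, O₁, O₂, h1, h1', h2, ⟨o, ho⟩, hs⟩ := hr.exists_separation hT hxy
  rcases hs x (mem_of_mem_nhds hV) y (mem_of_mem_nhds hW) with h' | h'
  · exact ⟨O₁, h1, h1', h'⟩
  · obtain ⟨a1, a2, a3, a4⟩ := h' o ho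
    exact absurd (hr.antisymm _ _ h (hr.trans _ _ _ a1 a3)) hxy

/-- The ancestors of `x` form a closed set. The remaining predecessors form an open set, since a
whole subtree off the lineage of `x` compares with `x` in the same way. -/
lemma measurableSet_lower [MeasurableSpace T] [BorelSpace T] (hr : IsPlaneOrder ρ r) (x : T) :
    MeasurableSet {z | r z x} := by
  have hopen : IsOpen ({z | r z x} \ {z | Btw ρ z x}) := by
    rw [isOpen_iff_mem_nhds]
    rintro z ⟨hz, hzx⟩
    have hzx : ¬ Btw ρ z x := hzx
    have hne : hT.meet ρ x z ≠ z := fun h => hzx (h ▸ hT.meet_left ρ x z)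
    obtain ⟨c, h1, h2, h3⟩ := hT.exists_btw_strict hne
    have hmz := hT.meet_right ρ x z
    have hmc : Btw ρ (hT.meet ρ x z) c := by
      unfold Btw at *
      linarith [dist_triangle ρ (hT.meet ρ x z) c, dist_triangle ρ c z]
    have hcz : Btw ρ c z := by unfold Btw at *; linarith
    have hcx : ¬ Btw ρ c x := fun h => h2 ((hT.le_meet h hcz).antisymm hmc)
    filter_upwards [(hT.isOpen_btw ρ c).mem_nhds ⟨hcz, h3.symm⟩] with w hw
    exact ⟨hr.convex_left hcx hcz hw.1 hz, fun h => hcx (hw.1.trans h)⟩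
  have : {z | r z x} = ({z | r z x} \ {z | Btw ρ z x}) ∪ {z | Btw ρ z x} := by
    rw [sdiff_union_self]
    exact (union_eq_left.2 fun z hz => hr.of_btw z x hz).symm
  rw [this]
  exact hopen.measurableSet.union (isClosed_btw_mid ρ x).measurableSet

end IsPlaneOrder

end Separation

/-! ### The time interval of a point -/

section Measure

/-- Lower sets of a linear order with a countable order-dense subset. -/
lemma lowerSet_measurable_and_le {T : Type*} [MeasurableSpace T] {μ : Measure T}
    {le : T → T → Prop} (hrefl : ∀ x, le x x) (htot : ∀ x y, le x y ∨ le y x)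
    (htrans : ∀ x y z, le x y → le y z → le x z) {D : Set T} (hDc : D.Countable)
    (hD : ∀ x y, le x y → x ≠ y → ∃ d ∈ D, le x d ∧ le d y)
    (hm : ∀ d, MeasurableSet {z | le z d}) {A : Set T} (hA : ∀ x y, le x y → y ∈ A → x ∈ A) :
    MeasurableSet A ∧ ∀ a, (∀ d ∈ A, μ {z | le z d} ≤ a) → μ A ≤ a := by
  by_cases hmax : ∃ x ∈ A, ∀ y ∈ A, le y x
  · obtain ⟨x, hx, hmax⟩ := hmax
    have : A = {z | le z x} := Subset.antisymm hmax fun z hz => hA z x hz hx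
    exact ⟨this ▸ hm x, fun a ha => (congrArg μ this).trans_le (ha x hx)⟩
  -- Without a greatest element, `A` is the directed union of the rays below the points of `D ∩ A`,
  -- and continuity from below bounds its mass.
  · push Not at hmax
    have hDA : (D ∩ A).Countable := hDc.mono inter_subset_left
    have : A = ⋃ d ∈ D ∩ A, {z | le z d} := by
      apply Subset.antisymm
      · intro x hx
        obtain ⟨y, hy, hyx⟩ := hmax x hx
        obtain ⟨d, hd, h1, h2⟩ := hD x y ((htot x y).resolve_right hyx)
          (by rintro rfl; exact hyx (hrefl x))
        exact mem_biUnion ⟨hd, hA d y h2 hy⟩ h1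
      · exact iUnion₂_subset fun d hd z hz => hA z d hz hd.2
    refine ⟨?_, fun a ha => ?_⟩
    · rw [this]
      exact MeasurableSet.biUnion hDA fun d _ => hm d
    · rw [this, measure_biUnion_eq_iSup hDA]
      · exact iSup₂_le fun d hd => ha d hd.2
      · intro x hx y hy
        rcases htot x y with h | h
        · exact ⟨y, hy, fun z hz => htrans _ _ _ hz h, Subset.rfl⟩
        · exact ⟨x, hx, Subset.rfl, fun z hz => htrans _ _ _ hz h⟩

variable {T : Type*} [MetricSpace T] [MeasurableSpace T]

/-- The mass of the points that strictly precede `x`. -/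
def lowerMass (μ : Measure T) (r : T → T → Prop) (x : T) : ℝ := μ.real {z | r z x ∧ z ≠ x}

/-- The mass of the points that precede `x` or are equal to `x`. -/
def upperMass (μ : Measure T) (r : T → T → Prop) (x : T) : ℝ := μ.real {z | r z x}

lemma lowerMass_nonneg (μ : Measure T) (r : T → T → Prop) (x : T) : 0 ≤ lowerMass μ r x :=
  measureReal_nonneg

lemma upperMass_le (μ : Measure T) [IsFiniteMeasure μ] (r : T → T → Prop) (x : T) :
    upperMass μ r x ≤ μ.real univ := measureReal_mono (subset_univ _)

lemma lowerMass_le_upperMass (μ : Measure T) [IsFiniteMeasure μ] (r : T → T → Prop) (x : T) :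
    lowerMass μ r x ≤ upperMass μ r x := measureReal_mono fun _ h => h.1

namespace IsPlaneOrder

variable {ρ : T} {r : T → T → Prop} [BorelSpace T] {μ : Measure T} [IsFiniteMeasure μ]
  [μ.IsOpenPosMeasure]

lemma lowerMass_root (hr : IsPlaneOrder ρ r) : lowerMass μ r ρ = 0 := by
  have : {z | r z ρ ∧ z ≠ ρ} = ∅ := by
    ext z
    simp only [mem_ofPred_eq, mem_empty_iff_false, iff_false, not_and, not_not]
    exact fun h => hr.antisymm _ _ h (hr.of_btw _ _ (btw_left _ _))
  rw [lowerMass, this, measureReal_empty]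

lemma lowerMass_add (hr : IsPlaneOrder ρ r) (x : T) :
    lowerMass μ r x + μ.real {x} = upperMass μ r x := by
  unfold lowerMass upperMass
  rw [← measureReal_union (by simp) (measurableSet_singleton x)]
  congr 1
  ext z
  simp only [mem_union, mem_ofPred_eq, mem_singleton_iff]
  constructor
  · rintro (h | rfl)
    · exact h.1
    · exact hr.refl z
  · intro h
    by_cases hz : z = x
    · exact Or.inr hz
    · exact Or.inl ⟨h, hz⟩

variable (hT : IsRealTree T)
include hT

/-- Turns order separation into a gap in time: the mass of `O` fits between the two intervals. -/
lemma upperMass_add_le (hr : IsPlaneOrder ρ r) {x y : T} {O : Set T} (hO : IsOpen O)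
    (h : ∀ o ∈ O, SBtw r x o y) : upperMass μ r x + μ.real O ≤ lowerMass μ r y ∨ O = ∅ := by
  rcases O.eq_empty_or_nonempty with h0 | ⟨o, ho⟩
  · exact Or.inr h0
  refine Or.inl ?_
  have hdisj : Disjoint {z | r z x} O := by
    rw [Set.disjoint_left]
    intro z hz hz'
    exact (h z hz').2.1 (hr.antisymm _ _ (h z hz').1 hz)
  unfold upperMass lowerMass
  rw [← measureReal_union hdisj hO.measurableSet]
  refine measureReal_mono ?_
  rintro z (hz | hz)
  · have hxo := h o ho
    have hzo := hr.trans _ _ _ hz hxo.1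
    refine ⟨hr.trans _ _ _ hzo hxo.2.2.1, ?_⟩
    rintro rfl
    exact hxo.2.2.2 (hr.antisymm _ _ hxo.2.2.1 hzo)
  · exact ⟨(h z hz).2.2.1, (h z hz).2.2.2⟩

lemma upperMass_lt_lowerMass (hr : IsPlaneOrder ρ r) {x y : T} (h : r x y) (hxy : x ≠ y) :
    upperMass μ r x < lowerMass μ r y := by
  obtain ⟨O, hO, hO', hs⟩ := hr.exists_open_sbtw hT h hxy
  have h1 := (hr.upperMass_add_le (μ := μ) hT hO hs).resolve_right hO'.ne_empty
  have : 0 < μ.real O := ENNReal.toReal_pos (hO.measure_pos μ hO').ne' (measure_ne_top _ _)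
  linarith

lemma rel_iff (hr : IsPlaneOrder ρ r) {x y : T} :
    r x y ↔ lowerMass μ r x ≤ lowerMass μ r y := by
  have key : ∀ x y, r x y → lowerMass μ r x ≤ lowerMass μ r y := by
    intro x y h
    by_cases hxy : x = y
    · rw [hxy]
    · exact (lowerMass_le_upperMass μ r x).trans (hr.upperMass_lt_lowerMass hT h hxy).le
  refine ⟨key x y, fun h => ?_⟩
  rcases hr.total x y with h' | h'
  · exact h'
  · by_cases hxy : y = x
    · rw [hxy]; exact hr.refl x
    · have := hr.upperMass_lt_lowerMass (μ := μ) hT h' hxy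
      linarith [lowerMass_le_upperMass μ r y]

/-- Distinct points occupy disjoint time intervals. -/
lemma eq_of_mem_Icc (hr : IsPlaneOrder ρ r) {x y : T} {t : ℝ}
    (hx : t ∈ Icc (lowerMass μ r x) (upperMass μ r x))
    (hy : t ∈ Icc (lowerMass μ r y) (upperMass μ r y)) : x = y := by
  by_contra hxy
  rcases hr.total x y with h | h
  · have := hr.upperMass_lt_lowerMass (μ := μ) hT h hxy
    linarith [hx.2, hy.1]
  · have := hr.upperMass_lt_lowerMass (μ := μ) hT h (Ne.symm hxy)
    linarith [hx.1, hy.2]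

lemma rel_of_mem_Icc (hr : IsPlaneOrder ρ r) {x y : T} {s t : ℝ} (hst : s ≤ t)
    (hx : s ∈ Icc (lowerMass μ r x) (upperMass μ r x))
    (hy : t ∈ Icc (lowerMass μ r y) (upperMass μ r y)) : r x y := by
  by_cases hxy : x = y
  · rw [hxy]; exact hr.refl y
  rcases hr.total x y with h | h
  · exact h
  · have := hr.upperMass_lt_lowerMass (μ := μ) hT h (Ne.symm hxy)
    linarith [hx.1, hy.2]

/-- Points at distance at least `ε` occupy time intervals at distance at least `δ`. -/
lemma exists_uniform_separation [CompactSpace T] (hr : IsPlaneOrder ρ r) {ε : ℝ} (hε : 0 < ε) :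
    ∃ δ > 0, ∀ x y, ∀ s ∈ Icc (lowerMass μ r x) (upperMass μ r x),
      ∀ t ∈ Icc (lowerMass μ r y) (upperMass μ r y), |s - t| < δ → dist x y < ε := by
  have hK : IsCompact {p : T × T | ε ≤ dist p.1 p.2} :=
    (isClosed_le continuous_const (by fun_prop)).isCompact
  have main : ∃ δ > 0, ∀ p ∈ {p : T × T | ε ≤ dist p.1 p.2},
      upperMass μ r p.1 + δ ≤ lowerMass μ r p.2 ∨ upperMass μ r p.2 + δ ≤ lowerMass μ r p.1 := by
    -- Near a pair of distinct points the gap is at least the smaller mass of the two separating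
    -- open sets; compactness makes it uniform.
    refine hK.induction_on (p := fun S => ∃ δ > 0, ∀ p ∈ S,
      upperMass μ r p.1 + δ ≤ lowerMass μ r p.2 ∨ upperMass μ r p.2 + δ ≤ lowerMass μ r p.1)
      ⟨1, one_pos, by simp⟩ ?_ ?_ ?_
    · rintro s t hst ⟨δ, hδ, h⟩
      exact ⟨δ, hδ, fun p hp => h p (hst hp)⟩
    · rintro s t ⟨δ, hδ, h⟩ ⟨δ', hδ', h'⟩
      refine ⟨min δ δ', lt_min hδ hδ', ?_⟩
      rintro p (hp | hp)
      · have := min_le_left δ δ'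
        exact (h p hp).imp (fun h => by linarith) (fun h => by linarith)
      · have := min_le_right δ δ'
        exact (h' p hp).imp (fun h => by linarith) (fun h => by linarith)
    · rintro ⟨x, y⟩ hxy
      have hne : x ≠ y := by
        rintro rfl
        have : ε ≤ dist x x := hxy
        rw [dist_self] at this; linarith
      obtain ⟨V, hV, W, hW, O₁, O₂, h1, h1', h2, h2', hs⟩ := hr.exists_separation hT hne
      have p1 : 0 < μ.real O₁ := ENNReal.toReal_pos (h1.measure_pos μ h1').ne' (measure_ne_top _ _)
      have p2 : 0 < μ.real O₂ := ENNReal.toReal_pos (h2.measure_pos μ h2').ne' (measure_ne_top _ _)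
      refine ⟨V ×ˢ W, mem_nhdsWithin_of_mem_nhds (prod_mem_nhds hV hW), min (μ.real O₁) (μ.real O₂),
        lt_min p1 p2, ?_⟩
      rintro ⟨a, b⟩ ⟨ha, hb⟩
      have m1 := min_le_left (μ.real O₁) (μ.real O₂)
      have m2 := min_le_right (μ.real O₁) (μ.real O₂)
      rcases hs a ha b hb with h | h
      · have := (hr.upperMass_add_le (μ := μ) hT h1 h).resolve_right h1'.ne_empty
        exact Or.inl (by dsimp only; linarith)
      · have := (hr.upperMass_add_le (μ := μ) hT h2 h).resolve_right h2'.ne_empty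
        exact Or.inr (by dsimp only; linarith)
  obtain ⟨δ, hδ, h⟩ := main
  refine ⟨δ, hδ, fun x y s hs t ht hst => ?_⟩
  by_contra hxy
  rw [abs_lt] at hst
  rcases h (x, y) (not_lt.1 hxy) with h | h <;> dsimp only at h
  · linarith [hs.2, ht.1]
  · linarith [hs.1, ht.2]

lemma exists_countable_dense [CompactSpace T] (hr : IsPlaneOrder ρ r) :
    ∃ D : Set T, D.Countable ∧ ∀ x y, r x y → x ≠ y → ∃ d ∈ D, SBtw r x d y := by
  obtain ⟨D, hDc, hD⟩ := TopologicalSpace.exists_countable_dense T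
  refine ⟨D, hDc, fun x y h hxy => ?_⟩
  obtain ⟨O, hO, hO', hs⟩ := hr.exists_open_sbtw hT h hxy
  obtain ⟨d, hd, hdO⟩ := hD.exists_mem_open hO hO'
  exact ⟨d, hd, hs d hdO⟩

omit [IsFiniteMeasure μ] [μ.IsOpenPosMeasure] in
lemma lowerSet [CompactSpace T] (hr : IsPlaneOrder ρ r) {A : Set T}
    (hA : ∀ x y, r x y → y ∈ A → x ∈ A) :
    MeasurableSet A ∧ ∀ a, (∀ d ∈ A, μ {z | r z d} ≤ a) → μ A ≤ a := by
  obtain ⟨D, hDc, hD⟩ := hr.exists_countable_dense hT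
  refine lowerSet_measurable_and_le hr.refl hr.total hr.trans hDc (fun x y h hxy => ?_)
    (hr.measurableSet_lower hT) hA
  obtain ⟨d, hd, h⟩ := hD x y h hxy
  exact ⟨d, hd, h.1, h.2.2.1⟩

omit [IsFiniteMeasure μ] [μ.IsOpenPosMeasure] in
lemma measurableSet_strict (hr : IsPlaneOrder ρ r) (x : T) :
    MeasurableSet {z | r z x ∧ z ≠ x} :=
  (hr.measurableSet_lower hT x).inter (measurableSet_singleton x).compl

omit [IsFiniteMeasure μ] [μ.IsOpenPosMeasure] in
lemma compl_strict (hr : IsPlaneOrder ρ r) (x : T) :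
    {z | r z x ∧ z ≠ x}ᶜ = {z | r x z} := by
  ext z
  simp only [mem_compl_iff, mem_ofPred_eq, not_and, not_not]
  constructor
  · intro h
    rcases hr.total x z with h' | h'
    · exact h'
    · rw [h h']; exact hr.refl x
  · intro h h'
    exact hr.antisymm _ _ h' h

omit [IsFiniteMeasure μ] [μ.IsOpenPosMeasure] in
lemma upperSet [CompactSpace T] (hr : IsPlaneOrder ρ r) {A : Set T}
    (hA : ∀ x y, r y x → y ∈ A → x ∈ A) :
    MeasurableSet A ∧ ∀ a, (∀ d ∈ A, μ {z | r d z} ≤ a) → μ A ≤ a := by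
  obtain ⟨D, hDc, hD⟩ := hr.exists_countable_dense hT
  refine lowerSet_measurable_and_le (le := fun x y => r y x) hr.refl (fun x y => hr.total y x)
    (fun x y z h h' => hr.trans _ _ _ h' h) hDc (fun x y h hxy => ?_) (fun d => ?_) hA
  · obtain ⟨d, hd, h⟩ := hD y x h (Ne.symm hxy)
    exact ⟨d, hd, h.2.2.1, h.1⟩
  · rw [← hr.compl_strict hT d]
    exact (hr.measurableSet_strict hT d).compl

lemma measurable_lowerMass [CompactSpace T] (hr : IsPlaneOrder ρ r) :
    Measurable (lowerMass μ r) :=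
  measurable_of_Iic fun _ => (hr.lowerSet (μ := μ) hT fun _ _ hxy hy =>
    ((hr.rel_iff hT).1 hxy).trans hy).1

lemma measurable_upperMass [CompactSpace T] (hr : IsPlaneOrder ρ r) :
    Measurable (upperMass μ r) :=
  measurable_of_Iic fun _ => (hr.lowerSet (μ := μ) hT fun x y hxy hy =>
    (measureReal_mono (fun _ hz => hr.trans _ _ _ hz hxy) : upperMass μ r x ≤ upperMass μ r y).trans
      hy).1

end IsPlaneOrder

end Measure

/-! ### From the measure to Lebesgue measure, and the contour path -/

section Contour

variable {T : Type*} [MetricSpace T] [MeasurableSpace T]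

/-- The time in the interval of `p.1` at relative position `p.2`. -/
def spread (μ : Measure T) (r : T → T → Prop) (p : T × unitInterval) : ℝ :=
  lowerMass μ r p.1 + p.2 * (upperMass μ r p.1 - lowerMass μ r p.1)

lemma spread_mem (μ : Measure T) [IsFiniteMeasure μ] (r : T → T → Prop) (p : T × unitInterval) :
    spread μ r p ∈ Icc (lowerMass μ r p.1) (upperMass μ r p.1) := by
  have h := lowerMass_le_upperMass μ r p.1
  have h0 := p.2.2.1
  have h1 := p.2.2.2
  unfold spread
  constructor <;> nlinarith

namespace IsPlaneOrder

variable {ρ : T} {r : T → T → Prop} [CompactSpace T] [BorelSpace T] {μ : Measure T}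
  [IsFiniteMeasure μ] [μ.IsOpenPosMeasure] (hT : IsRealTree T)
include hT

lemma measurable_spread (hr : IsPlaneOrder ρ r) : Measurable (spread μ r) := by
  have hf : Measurable fun p : T × unitInterval => p.1 := measurable_fst
  have h1 := (hr.measurable_lowerMass (μ := μ) hT).comp hf
  have h2 := (hr.measurable_upperMass (μ := μ) hT).comp hf
  have h3 : Measurable fun p : T × unitInterval => (p.2 : ℝ) :=
    measurable_subtype_coe.comp measurable_snd
  exact h1.add (h3.mul (h2.sub h1))

/-- Either `t` cuts the interval of an atom, and the second coordinate supplies the missing fraction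
of that atom, or `t` cuts no interval, and then the points before `t` have mass exactly `t`. -/
lemma measure_spread_le (hr : IsPlaneOrder ρ r) {t : ℝ} (ht : t ∈ Icc 0 (μ.real univ)) :
    (μ.prod volume) {p | spread μ r p ≤ t} = ENNReal.ofReal t := by
  by_cases hx : ∃ x, lowerMass μ r x ≤ t ∧ t < upperMass μ r x
  · obtain ⟨x, hx1, hx2⟩ := hx
    have hpos : 0 < upperMass μ r x - lowerMass μ r x := by linarith
    let v : unitInterval := ⟨(t - lowerMass μ r x) / (upperMass μ r x - lowerMass μ r x),
      div_nonneg (by linarith) hpos.le, (div_le_one hpos).2 (by linarith)⟩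
    have hset : {p | spread μ r p ≤ t} = {z | r z x ∧ z ≠ x} ×ˢ univ ∪ {x} ×ˢ Iic v := by
      ext ⟨z, u⟩
      simp only [mem_ofPred_eq, mem_union, mem_prod, mem_univ, and_true, mem_singleton_iff,
        mem_Iic]
      have hs := spread_mem μ r (z, u)
      dsimp only at hs
      by_cases hz : z = x
      · subst hz
        have : spread μ r (z, u) ≤ t ↔ u ≤ v := by
          rw [← Subtype.coe_le_coe]
          change _ ↔ (u : ℝ) ≤ (t - lowerMass μ r z) / (upperMass μ r z - lowerMass μ r z)
          rw [le_div_iff₀ hpos, spread, le_sub_iff_add_le']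
        simp [this]
      · simp only [hz, false_and, or_false, ne_eq, not_false_eq_true, and_true]
        constructor
        · intro h
          by_contra hzx
          have := hr.upperMass_lt_lowerMass (μ := μ) hT ((hr.total z x).resolve_left hzx)
            (Ne.symm hz)
          linarith [hs.1]
        · intro h
          have := hr.upperMass_lt_lowerMass (μ := μ) hT h hz
          linarith [hs.2]
    have hdisj : Disjoint ({z | r z x ∧ z ≠ x} ×ˢ (univ : Set unitInterval)) ({x} ×ˢ Iic v) := by
      rw [Set.disjoint_left]
      rintro ⟨z, u⟩ h1 h2
      exact h1.1.2 h2.1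
    rw [hset, measure_union hdisj ((measurableSet_singleton x).prod measurableSet_Iic),
      Measure.prod_prod, Measure.prod_prod, measure_univ, mul_one, unitInterval.volume_Iic,
      ← ofReal_measureReal, ← ofReal_measureReal, ← ENNReal.ofReal_mul measureReal_nonneg,
      ← ENNReal.ofReal_add measureReal_nonneg (mul_nonneg measureReal_nonneg v.2.1)]
    congr 1
    have h := hr.lowerMass_add (μ := μ) x
    change lowerMass μ r x + μ.real {x} *
      ((t - lowerMass μ r x) / (upperMass μ r x - lowerMass μ r x)) = t
    rw [← eq_sub_iff_add_eq'] at h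
    rw [h, mul_div_cancel₀ _ hpos.ne']
    ring
  · push Not at hx
    have hset : {p | spread μ r p ≤ t} = {z | upperMass μ r z ≤ t} ×ˢ univ := by
      ext ⟨z, u⟩
      simp only [mem_ofPred_eq, mem_prod, mem_univ, and_true]
      have hs := spread_mem μ r (z, u)
      exact ⟨fun h => hx z (hs.1.trans h), fun h => hs.2.trans h⟩
    rw [hset, Measure.prod_prod, measure_univ, mul_one]
    have hmono : ∀ x y, r x y → upperMass μ r x ≤ upperMass μ r y := fun x y hxy =>
      measureReal_mono fun z hz => hr.trans _ _ _ hz hxy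
    obtain ⟨hm, hle⟩ := hr.lowerSet (μ := μ) hT (A := {z | upperMass μ r z ≤ t})
      fun x y hxy hy => (hmono x y hxy).trans hy
    refine le_antisymm (hle _ fun d hd => ?_) ?_
    · rw [← ofReal_measureReal]
      exact ENNReal.ofReal_le_ofReal hd
    -- The lower bound comes from the complement: since no interval straddles `t`, each of its
    -- points has all its interval after `t`, so upper rays have mass at most the total minus `t`.
    · have hc : μ {z | upperMass μ r z ≤ t}ᶜ ≤ ENNReal.ofReal (μ.real univ - t) := by
        refine (hr.upperSet (μ := μ) hT (A := {z | upperMass μ r z ≤ t}ᶜ) ?_).2 _ ?_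
        · intro x y hxy hy hx
          exact hy ((hmono y x hxy).trans hx)
        · intro d hd
          have hd' : t < lowerMass μ r d := by
            by_contra hc
            exact hd (hx d (not_lt.1 hc))
          rw [← ofReal_measureReal]
          refine ENNReal.ofReal_le_ofReal ?_
          rw [← hr.compl_strict hT d, measureReal_compl (hr.measurableSet_strict hT d)]
          change μ.real univ - lowerMass μ r d ≤ _
          linarith
      have hsum := measureReal_add_measureReal_compl (μ := μ) hm
      have hc' : μ.real {z | upperMass μ r z ≤ t}ᶜ ≤ μ.real univ - t :=
        ENNReal.toReal_le_of_le_ofReal (by linarith [ht.2]) hc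
      rw [← ofReal_measureReal]
      exact ENNReal.ofReal_le_ofReal (by linarith)

/-- The spread of the measure is the Lebesgue measure. -/
lemma map_spread (hr : IsPlaneOrder ρ r) :
    (μ.prod volume).map (spread μ r) = volume.restrict (Icc 0 (μ.real univ)) := by
  have hm := hr.measurable_spread (μ := μ) hT
  have h0 : ∀ p, 0 ≤ spread μ r p := fun p => (lowerMass_nonneg μ r _).trans (spread_mem μ r p).1
  have h1 : ∀ p, spread μ r p ≤ μ.real univ := fun p =>
    (spread_mem μ r p).2.trans (upperMass_le μ r _)
  refine Measure.ext_of_Iic _ _ fun t => ?_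
  rw [Measure.map_apply hm measurableSet_Iic, Measure.restrict_apply measurableSet_Iic]
  change (μ.prod volume) {p | spread μ r p ≤ t} = _
  rcases lt_or_ge t 0 with ht | ht
  · have e1 : {p | spread μ r p ≤ t} = ∅ := by
      ext p; simpa using ht.trans_le (h0 p)
    have e2 : Iic t ∩ Icc 0 (μ.real univ) = ∅ := by
      ext s; simp only [mem_inter_iff, mem_Iic, mem_Icc, mem_empty_iff_false, iff_false]
      rintro ⟨a, b, -⟩; linarith
    rw [e1, e2, measure_empty, measure_empty]
  rcases le_or_gt t (μ.real univ) with ht' | ht'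
  · have e2 : Iic t ∩ Icc 0 (μ.real univ) = Icc 0 t := by
      ext s; simp only [mem_inter_iff, mem_Iic, mem_Icc]
      exact ⟨fun h => ⟨h.2.1, h.1⟩, fun h => ⟨h.2, h.1, h.2.trans ht'⟩⟩
    rw [e2, Real.volume_Icc, sub_zero]
    exact hr.measure_spread_le hT ⟨ht, ht'⟩
  · have e1 : {p | spread μ r p ≤ t} = {p | spread μ r p ≤ μ.real univ} := by
      ext p; exact ⟨fun _ => h1 p, fun h => h.trans ht'.le⟩
    have e2 : Iic t ∩ Icc 0 (μ.real univ) = Icc 0 (μ.real univ) :=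
      inter_eq_right.2 fun s hs => hs.2.trans ht'.le
    rw [e1, e2, Real.volume_Icc, sub_zero]
    exact hr.measure_spread_le hT ⟨measureReal_nonneg, le_rfl⟩

lemma exists_mem_Ioo (hr : IsPlaneOrder ρ r) {a b : ℝ} (ha : 0 ≤ a) (hab : a < b)
    (hb : b ≤ μ.real univ) :
    ∃ t ∈ Ioo a b, ∃ x, t ∈ Icc (lowerMass μ r x) (upperMass μ r x) := by
  have h : (μ.prod volume).map (spread μ r) (Ioo a b) ≠ 0 := by
    rw [hr.map_spread hT, Measure.restrict_apply measurableSet_Ioo,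
      inter_eq_left.2 (show Ioo a b ⊆ Icc 0 (μ.real univ) from
        fun s hs => ⟨ha.trans hs.1.le, hs.2.le.trans hb⟩), Real.volume_Ioo]
    simpa using hab
  rw [Measure.map_apply (hr.measurable_spread hT) measurableSet_Ioo] at h
  obtain ⟨p, hp⟩ := nonempty_of_measure_ne_zero h
  exact ⟨_, hp, p.1, spread_mem μ r p⟩

omit hT in
lemma mass_pos (ρ : T) (μ : Measure T) [IsFiniteMeasure μ] [μ.IsOpenPosMeasure] :
    0 < μ.real univ :=
  ENNReal.toReal_pos (isOpen_univ.measure_pos μ ⟨ρ, mem_univ _⟩).ne' (measure_ne_top _ _)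

lemma exists_mem_nhds (hr : IsPlaneOrder ρ r) {t : ℝ} (ht : t ∈ Icc 0 (μ.real univ)) {V : Set ℝ}
    (hV : V ∈ 𝓝 t) : ∃ s ∈ V, ∃ x, s ∈ Icc (lowerMass μ r x) (upperMass μ r x) := by
  have hM := mass_pos ρ μ
  obtain ⟨ε, hε, hball⟩ := Metric.mem_nhds_iff.1 hV
  have h1 : max 0 (t - ε) < min (μ.real univ) (t + ε) :=
    max_lt (lt_min hM (by linarith [ht.1])) (lt_min (by linarith [ht.2]) (by linarith))
  obtain ⟨s, hs, hx⟩ := hr.exists_mem_Ioo (μ := μ) hT (le_max_left _ _) h1 (min_le_left _ _)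
  refine ⟨s, hball ?_, hx⟩
  rw [Metric.mem_ball, Real.dist_eq, abs_lt]
  have := (max_lt_iff.1 hs.1).2
  have := (lt_min_iff.1 hs.2).2
  constructor <;> linarith

/-- The contour path: a continuous path that sits at `x` during the interval of `x`. -/
lemma exists_contour (hr : IsPlaneOrder ρ r) : ∃ π : ℝ → T, Continuous π ∧
    ∀ x, ∀ t ∈ Icc (lowerMass μ r x) (upperMass μ r x), π t = x := by
  -- The graph of the partial map from times to points. Its closure projects onto all times by
  -- density and compactness, and uniform separation passes to the closure, which is thus the graph
  -- of a uniformly continuous map.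
  let G : Set (ℝ × T) := {p | p.1 ∈ Icc (lowerMass μ r p.2) (upperMass μ r p.2)}
  have hM := mass_pos ρ μ
  have hGsub : G ⊆ Icc 0 (μ.real univ) ×ˢ univ := fun p hp =>
    ⟨⟨(lowerMass_nonneg μ r _).trans hp.1, hp.2.trans (upperMass_le μ r _)⟩, mem_univ _⟩
  have hGc : IsCompact (closure G) :=
    (isCompact_Icc.prod isCompact_univ).of_isClosed_subset isClosed_closure
      (closure_minimal hGsub (isClosed_Icc.prod isClosed_univ))
  have hex : ∀ t ∈ Icc 0 (μ.real univ), ∃ x, (t, x) ∈ closure G := by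
    intro t ht
    have h1 : IsClosed (Prod.fst '' closure G) := (hGc.image continuous_fst).isClosed
    have h2 : t ∈ closure (Prod.fst '' closure G) := by
      rw [mem_closure_iff_nhds]
      intro V hV
      obtain ⟨s, hs, x, hx⟩ := hr.exists_mem_nhds (μ := μ) hT ht hV
      exact ⟨s, hs, (s, x), subset_closure hx, rfl⟩
    rw [h1.closure_eq] at h2
    obtain ⟨⟨s, x⟩, h, rfl⟩ := h2
    exact ⟨x, h⟩
  have huni : ∀ ε > 0, ∃ δ > 0, ∀ t x s y, (t, x) ∈ closure G → (s, y) ∈ closure G →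
      |t - s| < δ → dist x y < ε := by
    intro ε hε
    obtain ⟨δ, hδ, h⟩ := hr.exists_uniform_separation (μ := μ) hT (half_pos hε)
    refine ⟨δ / 2, half_pos hδ, fun t x s y ht hs hts => ?_⟩
    obtain ⟨⟨t', x'⟩, ht', hd⟩ := Metric.mem_closure_iff.1 ht (min (δ / 4) (ε / 4)) (by positivity)
    obtain ⟨⟨s', y'⟩, hs', hd'⟩ := Metric.mem_closure_iff.1 hs (min (δ / 4) (ε / 4)) (by positivity)
    rw [Prod.dist_eq] at hd hd'
    have a1 := ((le_max_left _ _).trans_lt hd).trans_le (min_le_left _ _)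
    have a2 := ((le_max_right _ _).trans_lt hd).trans_le (min_le_right _ _)
    have b1 := ((le_max_left _ _).trans_lt hd').trans_le (min_le_left _ _)
    have b2 := ((le_max_right _ _).trans_lt hd').trans_le (min_le_right _ _)
    dsimp only at a1 a2 b1 b2
    rw [Real.dist_eq] at a1 b1
    have := h x' y' t' ht' s' hs' (by
      rw [abs_lt] at *
      constructor <;> linarith)
    have := dist_triangle4 x x' y' y
    rw [dist_comm y' y] at this
    linarith
  have : Nonempty T := ⟨ρ⟩
  choose! g hg using hex
  -- Clamping the time extends the path continuously to the whole line.
  have hproj : ∀ t : ℝ, ((projIcc 0 (μ.real univ) hM.le t : ℝ), g (projIcc 0 (μ.real univ) hM.le t))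
      ∈ closure G := fun t => hg _ (projIcc 0 (μ.real univ) hM.le t).2
  refine ⟨fun t => g (projIcc 0 (μ.real univ) hM.le t), ?_, ?_⟩
  · have hc : Continuous fun t => (projIcc 0 (μ.real univ) hM.le t : ℝ) :=
      continuous_subtype_val.comp continuous_projIcc
    rw [Metric.continuous_iff] at hc ⊢
    intro t ε hε
    obtain ⟨δ, hδ, h⟩ := huni ε hε
    obtain ⟨η, hη, h'⟩ := hc t δ hδ
    exact ⟨η, hη, fun s hs => h _ _ _ _ (hproj s) (hproj t) (h' s hs)⟩
  · intro x t ht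
    have htM : t ∈ Icc 0 (μ.real univ) := (hGsub (show (t, x) ∈ G from ht)).1
    have h1 := hproj t
    dsimp only
    rw [projIcc_of_mem hM.le htM] at h1 ⊢
    refine dist_le_zero.1 (le_of_forall_gt_imp_ge_of_dense fun ε hε => ?_)
    obtain ⟨δ, hδ, h⟩ := huni ε hε
    exact (h _ _ _ _ h1 (subset_closure (show (t, x) ∈ G from ht)) (by simpa using hδ)).le

end IsPlaneOrder

end Contour

/-! ### The height of the contour codes the tree -/

section ContourHeight

variable {T : Type*} [MetricSpace T]

/-- The height function that records the distance to the root along a path started at the root. -/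
def pathHeight (ρ : T) (M : ℝ) (hM : 0 ≤ M) (π : ℝ → T) (hπ : Continuous π) (h0 : π 0 = ρ) :
    HeightFunction where
  lifetime := M
  lifetime_nonneg := hM
  toFun t := dist ρ (π t)
  nonneg _ := dist_nonneg
  map_zero := by simp [h0]
  tendsto_zero := by
    have hc : Continuous fun t : Icc (0 : ℝ) M => dist ρ (π t) := by fun_prop
    have := hc.tendsto ⟨0, left_mem_Icc.2 hM⟩
    simp only [h0, dist_self] at this
    exact this.mono_left nhdsWithin_le_nhds
  left_cont t := by
    have hc : Continuous fun t : Icc (0 : ℝ) M => dist ρ (π t) := by fun_prop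
    exact hc.continuousWithinAt
  right_lim t := by
    have hc : Continuous fun t : Icc (0 : ℝ) M => dist ρ (π t) := by fun_prop
    exact ⟨_, le_rfl, (hc.tendsto t).mono_left nhdsWithin_le_nhds⟩

variable [MeasurableSpace T] {ρ : T} {r : T → T → Prop} [CompactSpace T] [BorelSpace T]
  {μ : Measure T} [IsFiniteMeasure μ] [μ.IsOpenPosMeasure] (hT : IsRealTree T)

/-- `π` is a continuous path that sits at each point `x` during the interval of `x`. -/
structure IsContour (μ : Measure T) (r : T → T → Prop) (π : ℝ → T) : Prop where
  cont : Continuous π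
  eq_of_mem : ∀ x, ∀ t ∈ Icc (lowerMass μ r x) (upperMass μ r x), π t = x

namespace IsContour

variable {π : ℝ → T} (hπ : IsContour μ r π)
include hπ

omit [CompactSpace T] [BorelSpace T] [μ.IsOpenPosMeasure] in
lemma apply_lowerMass (x : T) : π (lowerMass μ r x) = x :=
  hπ.eq_of_mem x _ ⟨le_rfl, lowerMass_le_upperMass μ r x⟩

lemma apply_zero (hr : IsPlaneOrder ρ r) : π 0 = ρ := by
  rw [← hr.lowerMass_root (μ := μ)]
  exact hπ.apply_lowerMass ρ

include hT

/-- The contour stays above `c` between two times when it is above `c`. -/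
lemma btw_of_btw (hr : IsPlaneOrder ρ r) {c : T} {s q t : ℝ} (hs : 0 ≤ s) (hsq : s ≤ q)
    (hqt : q ≤ t) (ht : t ≤ μ.real univ) (h1 : Btw ρ c (π s)) (h2 : Btw ρ c (π t)) :
    Btw ρ c (π q) := by
  by_contra hq
  have hsq' : s < q := hsq.lt_of_ne (by rintro rfl; exact hq h1)
  have hqt' : q < t := hqt.lt_of_ne (by rintro rfl; exact hq h2)
  have hne : hT.meet ρ c (π q) ≠ c := fun h => hq (h ▸ hT.meet_right ρ c (π q))
  -- Lowering `c` to `c'` makes all three conditions open, so the three times can be moved, in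
  -- order, into intervals of points; there order-convexity of the subtree of `c'` gives the
  -- contradiction.
  obtain ⟨c', g1, g2, g3⟩ := hT.exists_btw_strict hne
  have hmc := hT.meet_left ρ c (π q)
  have hmc' : Btw ρ (hT.meet ρ c (π q)) c' := by
    unfold Btw at *
    linarith [dist_triangle ρ (hT.meet ρ c (π q)) c', dist_triangle ρ c' c]
  have hcc : Btw ρ c' c := by unfold Btw at *; linarith
  have hq' : ¬ Btw ρ c' (π q) := fun h => g2 ((hT.le_meet hcc h).antisymm hmc')
  have hV := hπ.cont.continuousAt.preimage_mem_nhds ((hT.isOpen_btw ρ c').mem_nhds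
    (show Btw ρ c' (π s) ∧ π s ≠ c' from
      ⟨hcc.trans h1, fun h => g3 (hcc.antisymm (h ▸ h1))⟩))
  have hW := hπ.cont.continuousAt.preimage_mem_nhds ((hT.isOpen_btw ρ c').mem_nhds
    (show Btw ρ c' (π t) ∧ π t ≠ c' from
      ⟨hcc.trans h2, fun h => g3 (hcc.antisymm (h ▸ h2))⟩))
  have hQ := hπ.cont.continuousAt.preimage_mem_nhds
    ((isClosed_btw ρ c').isOpen_compl.mem_nhds (show π q ∈ {y | Btw ρ c' y}ᶜ from hq'))
  obtain ⟨s', ⟨hs1, hs2⟩, x, hx⟩ := hr.exists_mem_nhds (μ := μ) hT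
    ⟨hs, by linarith⟩ (inter_mem hV (Iio_mem_nhds (show s < (s + q) / 2 by linarith)))
  obtain ⟨q', ⟨hq1, hq2⟩, y, hy⟩ := hr.exists_mem_nhds (μ := μ) hT (t := q)
    ⟨by linarith, by linarith⟩ (inter_mem hQ (Ioo_mem_nhds
      (show (s + q) / 2 < q by linarith) (show q < (q + t) / 2 by linarith)))
  obtain ⟨t', ⟨ht1, ht2⟩, z, hz⟩ := hr.exists_mem_nhds (μ := μ) hT (t := t)
    ⟨by linarith, ht⟩ (inter_mem hW (Ioi_mem_nhds (show (q + t) / 2 < t by linarith)))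
  simp only [mem_preimage, hπ.eq_of_mem x s' hx, hπ.eq_of_mem y q' hy, hπ.eq_of_mem z t' hz,
    mem_ofPred_eq, mem_compl_iff, mem_Iio, mem_Ioi, mem_Ioo] at *
  have hxy := hr.rel_of_mem_Icc hT (by linarith) hx hy
  have hyz := hr.rel_of_mem_Icc hT (by linarith) hy hz
  have := hr.antisymm _ _ hxy (hr.convex_right hq1 ht1.1 hs1.1 hyz)
  exact hq1 (this ▸ hs1.1)

lemma dist_meet_le (hr : IsPlaneOrder ρ r) {s q t : ℝ} (hs : s ∈ Icc 0 (μ.real univ))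
    (ht : t ∈ Icc 0 (μ.real univ)) (hq : q ∈ uIcc s t) :
    dist ρ (hT.meet ρ (π s) (π t)) ≤ dist ρ (π q) := by
  refine Btw.dist_le ?_
  rcases le_total s t with h | h
  · rw [uIcc_of_le h] at hq
    exact hπ.btw_of_btw hT hr hs.1 hq.1 hq.2 ht.2 (hT.meet_left _ _ _) (hT.meet_right _ _ _)
  · rw [uIcc_of_ge h] at hq
    exact hπ.btw_of_btw hT hr ht.1 hq.1 hq.2 hs.2 (hT.meet_right _ _ _) (hT.meet_left _ _ _)

/-- The spread measure is Lebesgue measure and only produces times inside intervals. -/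
lemma measure_compl (hr : IsPlaneOrder ρ r) :
    volume (Icc 0 (μ.real univ) \ ⋃ x, Icc (lowerMass μ r x) (upperMass μ r x)) = 0 := by
  let F : Set ℝ := {t | lowerMass μ r (π t) ≤ t ∧ t ≤ upperMass μ r (π t)}
  have hF : MeasurableSet F :=
    (measurableSet_le ((hr.measurable_lowerMass hT).comp hπ.cont.measurable) measurable_id).inter
      (measurableSet_le measurable_id ((hr.measurable_upperMass hT).comp hπ.cont.measurable))
  have h : (μ.prod volume).map (spread μ r) Fᶜ = 0 := by
    rw [Measure.map_apply (hr.measurable_spread hT) hF.compl]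
    convert measure_empty (μ := μ.prod volume)
    ext p
    simp only [mem_preimage, mem_compl_iff, mem_empty_iff_false, iff_false, not_not]
    have hp := spread_mem μ r p
    change _ ∧ _
    rw [hπ.eq_of_mem _ _ hp]
    exact hp
  rw [hr.map_spread hT, Measure.restrict_apply hF.compl] at h
  refine measure_mono_null ?_ h
  rintro t ⟨ht, ht'⟩
  exact ⟨fun hF' => ht' (mem_iUnion.2 ⟨π t, hF'⟩), ht⟩

lemma map_eq (hr : IsPlaneOrder ρ r) : (volume.restrict (Icc 0 (μ.real univ))).map π = μ := by
  rw [← hr.map_spread hT, Measure.map_map hπ.cont.measurable (hr.measurable_spread hT)]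
  have : π ∘ spread μ r = Prod.fst := by
    ext p
    exact hπ.eq_of_mem _ _ (spread_mem μ r p)
  rw [this, Measure.map_fst_prod, measure_univ, one_smul]

/-- A height function that records the heights along the contour codes the tree. -/
lemma isCodingHeight (hr : IsPlaneOrder ρ r) (h : HeightFunction) (hM : h.lifetime = μ.real univ)
    (hh : ∀ t, h.toFun t = dist ρ (π t)) : IsCodingHeight ρ r μ h := by
  have hI : ∀ t : Icc (0 : ℝ) h.lifetime, (t : ℝ) ∈ Icc 0 (μ.real univ) := fun t => hM ▸ t.2
  have huIcc : ∀ {s t q : Icc (0 : ℝ) h.lifetime}, q ∈ uIcc s t ↔ (q : ℝ) ∈ uIcc (s : ℝ) t := by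
    intro s t q
    rcases le_total s t with hst | hst
    · rw [uIcc_of_le hst, uIcc_of_le (Subtype.coe_le_coe.2 hst)]; rfl
    · rw [uIcc_of_ge hst, uIcc_of_ge (Subtype.coe_le_coe.2 hst)]; rfl
  -- A connected path passes through the meet of its end points, and by `dist_meet_le` it never goes
  -- lower; this makes `d_h` the tree distance.
  have hmin : ∀ s t : Icc (0 : ℝ) h.lifetime,
      h.minBetween s t = dist ρ (hT.meet ρ (π s) (π t)) := by
    intro s t
    apply le_antisymm
    · have hpre : IsPreconnected (π '' uIcc (s : ℝ) t) :=
        isPreconnected_uIcc.image _ hπ.cont.continuousOn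
      obtain ⟨q, hq, hqm⟩ := hT.mem_of_isPreconnected hpre (mem_image_of_mem _ left_mem_uIcc)
        (mem_image_of_mem _ right_mem_uIcc) (hT.btw_meet ρ (π s) (π t))
      have hqM : q ∈ Icc (0 : ℝ) h.lifetime := (uIcc_subset_Icc s.2 t.2) hq
      have hle := h.minBetween_le (s := s) (t := t) (r := ⟨q, hqM⟩) (huIcc.2 hq)
      rwa [hh, hqm] at hle
    · refine h.le_minBetween fun q hq => ?_
      rw [hh]
      exact hπ.dist_meet_le hT hr (hI s) (hI t) (huIcc.1 hq)
  have hdist : ∀ s t : Icc (0 : ℝ) h.lifetime, dist (h.proj s) (h.proj t) = dist (π s) (π t) := by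
    intro s t
    rw [h.dist_proj, HeightFunction.timeDist, hmin, hh, hh]
    have a1 := hT.meet_left ρ (π s) (π t)
    have a2 := hT.meet_right ρ (π s) (π t)
    have a3 := hT.btw_meet ρ (π s) (π t)
    unfold Btw at *
    rw [dist_comm (π s)] at a3
    linarith
  have hproj : ∀ s t : Icc (0 : ℝ) h.lifetime, h.proj s = h.proj t ↔ π s = π t := by
    intro s t
    rw [← dist_eq_zero, hdist, dist_eq_zero]
  have hL' : ∀ x, lowerMass μ r x ∈ Icc 0 (μ.real univ) := fun x =>
    ⟨lowerMass_nonneg μ r x, (lowerMass_le_upperMass μ r x).trans (upperMass_le μ r x)⟩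
  have hL : ∀ x, lowerMass μ r x ∈ Icc 0 h.lifetime := hM ▸ hL'
  let f₀ : T → h.Tree := fun x => h.proj ⟨lowerMass μ r x, hL x⟩
  have hf₀ : ∀ t : Icc (0 : ℝ) h.lifetime, h.proj t = f₀ (π t) := fun t =>
    (hproj _ _).2 (hπ.apply_lowerMass _).symm
  have hiso : Isometry f₀ := Isometry.of_dist_eq fun x y => by
    rw [hdist]
    simp only [hπ.apply_lowerMass]
  have hsurj : Function.Surjective f₀ := fun σ => by
    obtain ⟨t, rfl⟩ := SeparationQuotient.surjective_mk (X := h.Time) σ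
    exact ⟨π (show Icc (0 : ℝ) h.lifetime from t), (hf₀ t).symm⟩
  let f : T ≃ᵢ h.Tree := ⟨Equiv.ofBijective f₀ ⟨hiso.injective, hsurj⟩, hiso⟩
  have hf : ∀ x, f x = f₀ x := fun x => rfl
  have hfirst : ∀ x, h.firstVisit (f x) = lowerMass μ r x := by
    intro x
    refine IsLeast.csInf_eq ⟨⟨⟨_, hL x⟩, rfl, rfl⟩, ?_⟩
    rintro _ ⟨t, ht, rfl⟩
    have htx : π t = x := ((hproj _ _).1 ht).trans (hπ.apply_lowerMass x)
    by_contra hlt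
    rw [not_le] at hlt
    -- After an earlier visit the contour would stay above `x` until the interval of `x`, yet it
    -- would pass through the interval of some `y` starting before that of `x`, whereas descendants
    -- of `x` do not precede it.
    obtain ⟨q, hq, y, hy⟩ := hr.exists_mem_Ioo (μ := μ) hT t.2.1 hlt (hL' x).2
    have hxy : Btw ρ x (π q) := hπ.btw_of_btw hT hr t.2.1 hq.1.le hq.2.le (hL' x).2
      (by rw [htx]; exact btw_right _ _) (by rw [hπ.apply_lowerMass]; exact btw_right _ _)
    rw [hπ.eq_of_mem y q hy] at hxy
    have := (hr.rel_iff (μ := μ) hT).1 (hr.of_btw _ _ hxy)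
    linarith [hy.1, hq.2]
  have hexit : ∀ x, upperMass μ r x ≤ h.firstExit (f x) := by
    intro x
    refine le_csInf ⟨_, Or.inr rfl⟩ ?_
    rintro _ (⟨t, ⟨ht, ht'⟩, rfl⟩ | rfl)
    · rw [hfirst] at ht
      by_contra hlt
      apply ht'
      rw [hf₀, hf, hπ.eq_of_mem x t ⟨ht.le, (not_le.1 hlt).le⟩]
    · exact hM ▸ upperMass_le μ r x
  refine ⟨?_, f, ?_, ?_, ?_⟩
  · unfold HeightFunction.IsMinimal
    rw [hM]
    refine measure_mono_null (sdiff_subset_sdiff_right ?_) (hπ.measure_compl hT hr)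
    refine iUnion_subset fun x => ?_
    refine Subset.trans ?_ (subset_iUnion _ (f x))
    rw [hfirst]
    exact Icc_subset_Icc le_rfl (hexit x)
  · refine (hproj _ _).2 ?_
    rw [hπ.apply_lowerMass]
    exact (hπ.apply_zero hr).symm
  · intro x y
    rw [HeightFunction.treeLE, hfirst, hfirst]
    exact hr.rel_iff hT
  · have h1 : h.proj = f ∘ π ∘ ((↑) : Icc (0 : ℝ) h.lifetime → ℝ) := funext hf₀
    rw [HeightFunction.treeMeasure, h1, ← Measure.map_map f.continuous.measurable
      (hπ.cont.measurable.comp measurable_subtype_coe),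
      ← Measure.map_map hπ.cont.measurable measurable_subtype_coe,
      map_comap_subtype_coe measurableSet_Icc, hM, hπ.map_eq hT hr]

end IsContour

end ContourHeight

/-! ### Jumps and first visits of a general height function -/

namespace HeightFunction

variable (h : HeightFunction)

/-- The times at which the right limit differs from the value. -/
def jumps : Set (Icc (0 : ℝ) h.lifetime) :=
  {t | ∃ l < h.toFun t, Tendsto h.toFun (𝓝[>] t) (𝓝 l)}

/-- For rational `q`, the times where the function drops across `q` are isolated from the left:
left-continuity keeps it above `q` just before such a time, while after another such time it would
be below `q`. -/
lemma countable_jumps : h.jumps.Countable := by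
  let J : ℚ → Set (Icc (0 : ℝ) h.lifetime) := fun q =>
    {t | ∃ l : ℝ, l < q ∧ (q : ℝ) < h.toFun t ∧ Tendsto h.toFun (𝓝[>] t) (𝓝 l)}
  have hsub : h.jumps ⊆ ⋃ q, J q := by
    rintro t ⟨l, hl, ht⟩
    obtain ⟨q, hq1, hq2⟩ := exists_rat_btwn hl
    exact mem_iUnion.2 ⟨q, l, hq1, hq2, ht⟩
  refine (countable_iUnion fun q => ?_).mono hsub
  suffices hiso : J q ⊆ {t | t ∈ J q ∧ 𝓝[J q ∩ Iio t] t = ⊥} from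
    countable_setOfPred_isolated_left_within.mono hiso
  refine fun t ht => ⟨ht, ?_⟩
  have hev : ∀ᶠ s in 𝓝[≤] t, (q : ℝ) < h.toFun s :=
    (h.left_cont t).eventually (lt_mem_nhds ht.choose_spec.2.1)
  rw [← Filter.empty_mem_iff_bot]
  by_cases hb : ∃ a, a < t
  · obtain ⟨a, ha, hsub⟩ := (mem_nhdsLE_iff_exists_Ioc_subset' hb.choose_spec).1 hev
    rw [mem_nhdsWithin]
    refine ⟨Ioi a, isOpen_Ioi, ha, ?_⟩
    rintro s ⟨hs, hsJ, hst⟩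
    have hst : s < t := hst
    have hs : a < s := hs
    obtain ⟨l, hl, -, hlim⟩ := hsJ
    have := nhdsGT_neBot_of_exists_gt ⟨t, hst⟩
    have h1 : ∀ᶠ s' in 𝓝[>] s, h.toFun s' < q := hlim.eventually (gt_mem_nhds hl)
    obtain ⟨s', h2, h3⟩ := (h1.and (Ioo_mem_nhdsGT hst)).exists
    exact absurd (hsub ⟨hs.trans h3.1, h3.2.le⟩ : (q : ℝ) < h.toFun s') (not_lt.2 h2.le)
  · push Not at hb
    filter_upwards [self_mem_nhdsWithin] with s hs
    exact absurd hs.2 (not_lt.2 (hb s))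

lemma eventually_dist_proj_lt_right {t : Icc (0 : ℝ) h.lifetime} (ht : t ∉ h.jumps) {ε : ℝ}
    (hε : 0 < ε) : ∀ᶠ s in 𝓝[>] t, dist (h.proj s) (h.proj t) < ε := by
  obtain ⟨l, hl, hlim⟩ := h.right_lim t
  obtain rfl : l = h.toFun t := hl.eq_of_not_lt fun hlt => ht ⟨l, hlt, hlim⟩
  have hev : ∀ᶠ s in 𝓝[>] t, |h.toFun s - h.toFun t| < ε / 4 :=
    (Metric.tendsto_nhds.1 hlim) (ε / 4) (by linarith)
  by_cases hb : ∃ b, t < b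
  · obtain ⟨b, hb', hsub⟩ := (mem_nhdsGT_iff_exists_Ioo_subset' hb.choose_spec).1 hev
    filter_upwards [Ioo_mem_nhdsGT hb'] with s hs
    rw [dist_proj, timeDist]
    have h1 := abs_lt.1 (show |h.toFun s - h.toFun t| < ε / 4 from hsub hs)
    have h2 : h.toFun t - ε / 4 ≤ h.minBetween s t := by
      apply h.le_minBetween
      intro q hq
      rw [uIcc_of_ge hs.1.le] at hq
      rcases hq.1.eq_or_lt with rfl | hq'
      · linarith
      · have := abs_lt.1 (show |h.toFun q - h.toFun t| < ε / 4 from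
          hsub ⟨hq', hq.2.trans_lt hs.2⟩)
        linarith
    linarith
  · push Not at hb
    filter_upwards [self_mem_nhdsWithin] with s hs
    exact absurd hs (not_lt.2 (hb s))

lemma exists_proj (y : h.Tree) : ∃ t, h.proj t = y :=
  SeparationQuotient.surjective_mk (X := h.Time) y

lemma bddBelow_visits (y : h.Tree) :
    BddBelow (((↑) : Icc (0 : ℝ) h.lifetime → ℝ) '' (h.proj ⁻¹' {y})) :=
  ⟨0, by rintro _ ⟨t, -, rfl⟩; exact t.2.1⟩

lemma firstVisit_le (t : Icc (0 : ℝ) h.lifetime) : h.firstVisit (h.proj t) ≤ t :=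
  csInf_le (h.bddBelow_visits _) ⟨t, rfl, rfl⟩

lemma firstVisit_mem (y : h.Tree) : h.firstVisit y ∈ Icc 0 h.lifetime := by
  obtain ⟨t, rfl⟩ := h.exists_proj y
  refine ⟨le_csInf ⟨_, t, rfl, rfl⟩ ?_, (h.firstVisit_le t).trans t.2.2⟩
  rintro _ ⟨s, -, rfl⟩
  exact s.2.1

lemma exists_visit_lt {y : h.Tree} {a : ℝ} (ha : h.firstVisit y < a) :
    ∃ s, h.proj s = y ∧ h.firstVisit y ≤ s ∧ (s : ℝ) < a := by
  obtain ⟨t, ht⟩ := h.exists_proj y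
  obtain ⟨_, ⟨s, hs, rfl⟩, hsa⟩ := exists_lt_of_csInf_lt
    (s := ((↑) : Icc (0 : ℝ) h.lifetime → ℝ) '' (h.proj ⁻¹' {y})) ⟨_, t, ht, rfl⟩ ha
  have hs' : h.proj s = y := hs
  refine ⟨s, hs, ?_, hsa⟩
  rw [← hs']
  exact h.firstVisit_le s

lemma proj_eq_of_lt_firstExit {y : h.Tree} {t : Icc (0 : ℝ) h.lifetime}
    (h1 : h.firstVisit y < t) (h2 : t < h.firstExit y) : h.proj t = y := by
  by_contra hne
  have hle : h.firstExit y ≤ t := by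
    refine csInf_le ?_ (Or.inl ⟨t, ⟨h1, hne⟩, rfl⟩)
    refine ⟨0, ?_⟩
    rintro _ (⟨s, -, rfl⟩ | rfl)
    · exact s.2.1
    · exact h.lifetime_nonneg
  exact hle.not_gt h2

lemma firstExit_le_lifetime (y : h.Tree) : h.firstExit y ≤ h.lifetime := by
  refine csInf_le ⟨0, ?_⟩ (Or.inr rfl)
  rintro _ (⟨s, -, rfl⟩ | rfl)
  · exact s.2.1
  · exact h.lifetime_nonneg

/-- A time of first visit that is not a jump lies in the interval of the point it visits. -/
lemma le_firstExit_of_mem_firstVisitTimes {t : Icc (0 : ℝ) h.lifetime} (ht : t ∉ h.jumps)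
    (hF : (t : ℝ) ∈ h.firstVisitTimes) : (t : ℝ) ≤ h.firstExit (h.proj t) := by
  obtain ⟨y, hy1, hy2⟩ := mem_iUnion.1 hF
  suffices h.proj t = y by rwa [this]
  rcases hy1.eq_or_lt with h1 | h1
  -- The infimum defining the first visit need not be attained; then visits to `y` accumulate at `t`
  -- from the right, against right-continuity of the projection away from jumps.
  · by_contra hne
    have hd : 0 < dist y (h.proj t) := dist_pos.2 (Ne.symm hne)
    have hev := h.eventually_dist_proj_lt_right ht hd
    have hfreq : ∃ᶠ s in 𝓝[>] t, h.proj s = y := by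
      by_cases hb : ∃ b, t < b
      · rw [frequently_iff]
        intro V hV
        obtain ⟨b, hb', hsub⟩ := (mem_nhdsGT_iff_exists_Ioo_subset' hb.choose_spec).1 hV
        have hb'' : h.firstVisit y < b := by rw [h1]; exact hb'
        obtain ⟨s, hs, hs1, hs2⟩ := h.exists_visit_lt hb''
        refine ⟨s, hsub ⟨lt_of_le_of_ne ?_ ?_, hs2⟩, hs⟩
        · rw [h1] at hs1; exact hs1
        · rintro rfl; exact hne hs
      · push Not at hb
        exfalso
        obtain ⟨s, hs⟩ := h.exists_proj y
        have hst : t ≤ s := by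
          have := h.firstVisit_le s
          rw [hs, h1] at this
          exact this
        exact hne (by rw [le_antisymm hst (hb s)]; exact hs)
    obtain ⟨s, hs1, hs2⟩ := (hfreq.and_eventually hev).exists
    rw [hs1] at hs2
    exact hs2.false
  rcases hy2.lt_or_eq with h2 | h2
  · exact h.proj_eq_of_lt_firstExit h1 h2
  · by_contra hne
    have hd : 0 < dist y (h.proj t) := dist_pos.2 (Ne.symm hne)
    let a : Icc (0 : ℝ) h.lifetime := ⟨h.firstVisit y, h.firstVisit_mem y⟩
    have hat : a < t := h1
    have := nhdsLT_neBot_of_exists_lt ⟨a, hat⟩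
    have hev : ∀ᶠ s in 𝓝[<] t, dist (h.proj s) (h.proj t) < dist y (h.proj t) :=
      nhdsWithin_mono _ Iio_subset_Iic_self (h.eventually_dist_proj_lt t hd)
    obtain ⟨s, hs1, hs2⟩ := (hev.and (Ioo_mem_nhdsLT hat)).exists
    rw [h.proj_eq_of_lt_firstExit (y := y) hs2.1 (by rw [← h2]; exact hs2.2)] at hs1
    exact hs1.false

/-- Strictly between the first visit of its point and such a time `t`, the projection does not move,
so no new point can be discovered there. -/
lemma le_firstVisit_of_lt {t : Icc (0 : ℝ) h.lifetime} (ht : t ∉ h.jumps)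
    (hF : (t : ℝ) ∈ h.firstVisitTimes) {y : h.Tree}
    (hy : h.firstVisit (h.proj t) < h.firstVisit y) : t ≤ h.firstVisit y := by
  by_contra hlt
  obtain ⟨s, hs, hs1, hs2⟩ := h.exists_visit_lt (not_le.1 hlt)
  have := h.proj_eq_of_lt_firstExit (y := h.proj t) (t := s) (hy.trans_le hs1)
    (hs2.trans_le (h.le_firstExit_of_mem_firstVisitTimes ht hF))
  rw [hs] at this
  rw [this] at hy
  exact hy.false

/-- The height is recovered from the visited point alone, so uniqueness reduces to knowing which
point is visited. -/
lemma dist_root (t : Icc (0 : ℝ) h.lifetime) : dist h.root (h.proj t) = h.toFun t := by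
  have h0 := h.map_zero
  rw [root, dist_proj, timeDist, h0]
  have h1 := h.minBetween_le (s := ⟨0, left_mem_Icc.2 h.lifetime_nonneg⟩) (t := t) left_mem_uIcc
  have h2 : 0 ≤ h.minBetween ⟨0, left_mem_Icc.2 h.lifetime_nonneg⟩ t :=
    h.le_minBetween fun r _ => h.nonneg r
  rw [h0] at h1
  linarith

/-- The Lebesgue measure on `[0, M]`. -/
def timeMeasure : Measure (Icc (0 : ℝ) h.lifetime) := Measure.comap Subtype.val volume

lemma timeMeasure_apply (S : Set (Icc (0 : ℝ) h.lifetime)) :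
    h.timeMeasure S = volume (((↑) : Icc (0 : ℝ) h.lifetime → ℝ) '' S) :=
  comap_subtype_coe_apply measurableSet_Icc _ _

lemma timeMeasure_univ : h.timeMeasure univ = ENNReal.ofReal h.lifetime := by
  rw [timeMeasure_apply, image_univ, Subtype.range_coe, Real.volume_Icc, sub_zero]

lemma timeMeasure_null_of_countable {S : Set (Icc (0 : ℝ) h.lifetime)} (hS : S.Countable) :
    h.timeMeasure S = 0 := by
  rw [timeMeasure_apply]
  exact (hS.image _).measure_zero _

lemma timeMeasure_lt {a : ℝ} (ha : a ≤ h.lifetime) :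
    h.timeMeasure {t | (t : ℝ) < a} = ENNReal.ofReal a := by
  have : ((↑) : Icc (0 : ℝ) h.lifetime → ℝ) '' {t | (t : ℝ) < a} = Ico 0 a := by
    ext s
    constructor
    · rintro ⟨t, ht, rfl⟩; exact ⟨t.2.1, ht⟩
    · rintro hs; exact ⟨⟨s, hs.1, hs.2.le.trans ha⟩, hs.2, rfl⟩
  rw [timeMeasure_apply, this, Real.volume_Ico, sub_zero]

lemma IsMinimal.ae {h : HeightFunction} (hmin : h.IsMinimal) :
    ∀ᵐ t ∂h.timeMeasure, t ∉ h.jumps ∧ (t : ℝ) ∈ h.firstVisitTimes := by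
  refine Filter.Eventually.and ?_ ?_
  · rw [ae_iff]
    simp only [not_not]
    exact h.timeMeasure_null_of_countable h.countable_jumps
  · rw [ae_iff, timeMeasure_apply]
    refine measure_mono_null ?_ hmin
    rintro _ ⟨t, ht, rfl⟩
    exact ⟨t.2, ht⟩

lemma ext_of_toFun {h₁ h₂ : HeightFunction} (hM : h₁.lifetime = h₂.lifetime)
    (h : ∀ t ht₁ ht₂, h₁.toFun ⟨t, ht₁⟩ = h₂.toFun ⟨t, ht₂⟩) : h₁ = h₂ := by
  obtain ⟨M, hM₀, f, _, _, _, _, _⟩ := h₁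
  obtain ⟨M', hM₀', g, _, _, _, _, _⟩ := h₂
  dsimp only at hM h
  subst hM
  congr
  ext t
  exact h t t.2 t.2

end HeightFunction

/-! ### Uniqueness of the coding height function -/

section Uniqueness

variable {T : Type*} [MetricSpace T] [MeasurableSpace T] {ρ : T} {r : T → T → Prop}
  [CompactSpace T] [BorelSpace T] {μ : Measure T} [IsFiniteMeasure μ] [μ.IsOpenPosMeasure]

lemma IsCodingHeight.lifetime_eq {h : HeightFunction} (hh : IsCodingHeight ρ r μ h) :
    h.lifetime = μ.real univ := by
  obtain ⟨-, f, -, -, hμ⟩ := hh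
  have h1 : h.treeMeasure univ = ENNReal.ofReal h.lifetime := by
    rw [HeightFunction.treeMeasure, Measure.map_apply h.measurable_proj MeasurableSet.univ,
      preimage_univ]
    exact h.timeMeasure_univ
  rw [hμ, Measure.map_apply f.continuous.measurable MeasurableSet.univ, preimage_univ] at h1
  rw [Measure.real, h1, ENNReal.toReal_ofReal h.lifetime_nonneg]

/-- At almost every time, a coding height function visits the point whose interval contains this
time. -/
lemma IsCodingHeight.ae_toFun_eq (hT : IsRealTree T) (hr : IsPlaneOrder ρ r) {h : HeightFunction}
    (hh : IsCodingHeight ρ r μ h) :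
    ∀ᵐ t : Icc (0 : ℝ) h.lifetime ∂h.timeMeasure,
      ∃ x, (t : ℝ) ∈ Icc (lowerMass μ r x) (upperMass μ r x) ∧ h.toFun t = dist ρ x := by
  obtain ⟨hmin, f, hρ, hord, hμ⟩ := hh
  have hmass : ∀ A : Set T, MeasurableSet A → μ A = h.timeMeasure {t | f.symm (h.proj t) ∈ A} := by
    intro A hA
    have hB : MeasurableSet (f.symm ⁻¹' A) := f.symm.continuous.measurable hA
    have h1 := congrArg (fun ν : Measure h.Tree => ν (f.symm ⁻¹' A)) hμ
    rw [Measure.map_apply f.continuous.measurable hB, HeightFunction.treeMeasure,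
      Measure.map_apply h.measurable_proj hB] at h1
    have h2 : f ⁻¹' (f.symm ⁻¹' A) = A := by ext x; simp
    rw [h2] at h1
    exact h1.symm
  -- By minimality, up to a null set the times spent at strict predecessors of `x` are exactly the
  -- times before the first visit of `x`.
  have hlower : ∀ x, lowerMass μ r x = h.firstVisit (f x) := by
    intro x
    have h1 : μ {z | r z x ∧ z ≠ x} = ENNReal.ofReal (h.firstVisit (f x)) := by
      rw [hmass _ (hr.measurableSet_strict hT x), ← h.timeMeasure_lt (h.firstVisit_mem (f x)).2]
      have hx : ∀ᵐ t : Icc (0 : ℝ) h.lifetime ∂h.timeMeasure, (t : ℝ) ≠ h.firstVisit (f x) := by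
        rw [ae_iff]
        refine h.timeMeasure_null_of_countable (Set.Subsingleton.countable ?_)
        intro s hs t ht
        simp only [ne_eq, not_not, mem_ofPred_eq] at hs ht
        exact Subtype.ext (hs.trans ht.symm)
      refine measure_congr ?_
      filter_upwards [hmin.ae, hx] with t ⟨ht1, ht2⟩ ht3
      refine propext ?_
      have e1 : f.symm (h.proj t) ∈ {z | r z x ∧ z ≠ x} ↔
          h.firstVisit (h.proj t) < h.firstVisit (f x) := by
        rw [← not_iff_not, ← mem_compl_iff, hr.compl_strict hT x, mem_ofPred_eq, hord,
          HeightFunction.treeLE, f.apply_symm_apply, not_lt]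
      refine e1.trans ⟨fun hlt => ?_, fun hlt => ?_⟩
      · exact lt_of_le_of_ne (h.le_firstVisit_of_lt ht1 ht2 hlt) ht3
      · exact (h.firstVisit_le t).trans_lt hlt
    rw [lowerMass, Measure.real, h1, ENNReal.toReal_ofReal (h.firstVisit_mem _).1]
  -- The open interval from first visit to first exit is spent at `x`, so its length is at most `μ
  -- {x}`.
  have hupper : ∀ x, h.firstExit (f x) ≤ upperMass μ r x := by
    intro x
    rw [← hr.lowerMass_add, hlower, ← sub_le_iff_le_add', Measure.real,
      ← ENNReal.ofReal_le_iff_le_toReal (measure_ne_top _ _), hmass _ (measurableSet_singleton x),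
      h.timeMeasure_apply, ← Real.volume_Ioo]
    refine measure_mono ?_
    intro t ht
    refine ⟨⟨t, (h.firstVisit_mem (f x)).1.trans ht.1.le,
      ht.2.le.trans (h.firstExit_le_lifetime _)⟩, ?_, rfl⟩
    have := h.proj_eq_of_lt_firstExit (t := ⟨t, (h.firstVisit_mem (f x)).1.trans ht.1.le,
      ht.2.le.trans (h.firstExit_le_lifetime _)⟩) ht.1 ht.2
    simp [this]
  filter_upwards [hmin.ae] with t ⟨ht1, ht2⟩
  refine ⟨f.symm (h.proj t), ⟨?_, ?_⟩, ?_⟩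
  · rw [hlower, f.apply_symm_apply]
    exact h.firstVisit_le t
  · refine le_trans ?_ (hupper _)
    rw [f.apply_symm_apply]
    exact h.le_firstExit_of_mem_firstVisitTimes ht1 ht2
  · rw [← h.dist_root, ← hρ, ← f.dist_eq, f.apply_symm_apply]

/-- The two functions agree almost everywhere. If they differed at a positive time, left-continuity
would make them differ on an interval to its left, of positive length; at time 0 both vanish. -/
lemma IsCodingHeight.unique (hT : IsRealTree T) (hr : IsPlaneOrder ρ r) {h₁ h₂ : HeightFunction}
    (hh₁ : IsCodingHeight ρ r μ h₁) (hh₂ : IsCodingHeight ρ r μ h₂) : h₁ = h₂ := by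
  have hM : h₁.lifetime = h₂.lifetime := hh₁.lifetime_eq.trans hh₂.lifetime_eq.symm
  have hae₁ := hh₁.ae_toFun_eq hT hr
  have hae₂ := hh₂.ae_toFun_eq hT hr
  clear hh₁ hh₂
  obtain ⟨M, hM₀, f, _, f0, _, fc, _⟩ := h₁
  obtain ⟨M', hM₀', g, _, g0, _, gc, _⟩ := h₂
  dsimp only at hM
  subst hM
  refine HeightFunction.ext_of_toFun rfl fun t ht _ => ?_
  dsimp only [HeightFunction.timeMeasure] at *
  have hae : ∀ᵐ t : Icc (0 : ℝ) M ∂(Measure.comap Subtype.val volume), f t = g t := by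
    filter_upwards [hae₁, hae₂] with t ⟨x, hx, hfx⟩ ⟨y, hy, hgy⟩
    rw [hfx, hgy, hr.eq_of_mem_Icc hT hx hy]
  rcases ht.1.eq_or_lt with h0 | h0
  · subst h0
    exact f0.trans g0.symm
  by_contra hne
  set τ : Icc (0 : ℝ) M := ⟨t, ht⟩ with hτ
  have hev : ∀ᶠ s in 𝓝[≤] τ, f s - g s ≠ 0 :=
    ((fc τ).sub (gc τ)).eventually (isOpen_ne.mem_nhds (sub_ne_zero.2 hne))
  have h0τ : (⟨0, left_mem_Icc.2 hM₀⟩ : Icc (0 : ℝ) M) < τ := h0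
  obtain ⟨a, ha, hsub⟩ := (mem_nhdsLE_iff_exists_Ioc_subset' h0τ).1 hev
  have hnull : (Measure.comap ((↑) : Icc (0 : ℝ) M → ℝ) volume) (Ioc a τ) = 0 := by
    refine measure_mono_null (fun s hs => ?_) (ae_iff.1 hae)
    exact sub_ne_zero.1 (hsub hs)
  rw [comap_subtype_coe_apply measurableSet_Icc] at hnull
  have himg : Ioc (a : ℝ) t ⊆ ((↑) : Icc (0 : ℝ) M → ℝ) '' Ioc a τ := fun s hs =>
    ⟨⟨s, a.2.1.trans hs.1.le, hs.2.trans ht.2⟩, ⟨hs.1, hs.2⟩, rfl⟩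
  have := measure_mono_null himg hnull
  rw [Real.volume_Ioc, ENNReal.ofReal_eq_zero] at this
  have hat : (a : ℝ) < t := ha
  linarith

end Uniqueness

end RealTree

end

theorem proposition4p3 {T : Type*} [MetricSpace T] [CompactSpace T] [MeasurableSpace T]
    [BorelSpace T] (hT : RealTree.IsRealTree T) (ρ : T) (hleaves : Dense (RealTree.leaves ρ))
    {Ω : Type*} [MeasurableSpace Ω] (P : Measure Ω) [IsProbabilityMeasure P]
    (U : RealTree.ShuffleIndex ρ → Ω → ℝ) (hU : RealTree.IsIIDUniform P U) :
    ∀ᵐ ω ∂P, ∀ μ : Measure T, IsFiniteMeasure μ → μ.support = univ →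
      (∃! h : RealTree.HeightFunction,
        RealTree.IsCodingHeight ρ (RealTree.shuffleLE ρ fun i => U i ω) μ h) ∧
      ∀ h : RealTree.HeightFunction,
        RealTree.IsCodingHeight ρ (RealTree.shuffleLE ρ fun i => U i ω) μ h →
          Continuous h.toFun := by
  -- The almost sure event is fixed before `μ` is introduced.
  filter_upwards [hT.ae_isPlaneOrder hleaves hU] with ω hr μ hμ hsupp
  have : μ.IsOpenPosMeasure := ⟨fun O hO ⟨x, hx⟩ =>
    ((Measure.mem_support_iff_forall x).1 (hsupp ▸ mem_univ x) O (hO.mem_nhds hx)).ne'⟩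
  obtain ⟨π, hπc, hπ⟩ := hr.exists_contour (μ := μ) hT
  have hπ' : RealTree.IsContour μ (RealTree.shuffleLE ρ fun i => U i ω) π := ⟨hπc, hπ⟩
  let h₀ := RealTree.pathHeight ρ (μ.real univ) measureReal_nonneg π hπc (hπ'.apply_zero hr)
  have hcode := hπ'.isCodingHeight hT hr h₀ rfl fun _ => rfl
  refine ⟨⟨h₀, hcode, fun h hh => hh.unique hT hr hcode⟩, fun h hh => ?_⟩
  rw [hh.unique hT hr hcode]
  exact continuous_const.dist (hπc.comp continuous_subtype_val)
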